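/- For $v:\mathbb R\to\mathbb C$ in $H^1_{\rm loc}(\mathbb R)$ let $$E(v)=\frac12\int_{\mathbb R}|v'|^2+\frac14\int_{\mathbb R}(1-|v|^2)^2\in[0,+\infty]$$ be its Ginzburg–Landau energy. If $E(v)<\frac{2\sqrt2}{3}$, then $v$ (in its continuous representative) has no zero, so that $v=\varrho\exp(i\varphi)$ with $\varrho=|v|>0$ and a continuous real-valued phase $\varphi\in H^1_{\rm loc}(\mathbb R)$, unique up to a constant; its renormalized momentum is $$p(v)=\frac12\int_{\mathbb R}(1-\varrho^2)\,\varphi'.$$ For $0<c<\sqrt2$ let $$\mathfrak v_c(x)=\sqrt{\frac{2-c^2}{2}}\,\tanh\Big(\frac{\sqrt{2-c^2}}{2}\,x\Big)-i\,\frac{c}{\sqrt2}.$$ **Theorem.** Let $0<\mathfrak p<\frac{\pi}{2}$. There is exactly one $c=c(\mathfrak p)\in(0,\sqrt2)$ such that $$\mathfrak p=\frac{\pi}{2}-\arctan\Big(\frac{c}{\sqrt{2-c^2}}\Big)-\frac c2\sqrt{2-c^2}.$$ The set $$X_{\mathfrak p}=\Big\{v\in H^1_{\rm loc}(\mathbb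 R):\ E(v)<\frac{2\sqrt2}{3},\ p(v)=\mathfrak p\Big\}$$ is not empty, and $$E(\mathfrak v_{c(\mathfrak p)})=\inf\{E(v):\ v\in X_{\mathfrak p}\}.$$ The infimum is attained: $\mathfrak v_{c(\mathfrak p)}\in X_{\mathfrak p}$ is a minimizer, and it is the only one up to translations and multiplication by constants of modulus one. That is, $v$ is a minimizer if and only if there are $a,\theta\in\mathbb R$ such that $v(x)=e^{i\theta}\,\mathfrak v_{c(\mathfrak p)}(x-a)$ for almost every $x\in\mathbb R$. -/

import Mathlib

open MeasureTheory
open scoped ContDiff ENNReal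

namespace GP

noncomputable section

/-! ### Local Sobolev space `H¹_loc(ℝ)` -/

/-- `v ∈ L²_loc(ℝ)`: square integrable on every compact subset of `ℝ`. -/
def MemL2loc {F : Type*} [NormedAddCommGroup F] (v : ℝ → F) : Prop :=
  ∀ K : Set ℝ, IsCompact K → MemLp v 2 (volume.restrict K)

/-- `g` is a derivative of `v` in the sense of distributions on `ℝ` (both being locally
integrable). -/
structure IsWeakDeriv {F : Type*} [NormedAddCommGroup F] [NormedSpace ℝ F]
    (v g : ℝ → F) : Prop where
  locallyIntegrable : LocallyIntegrable v
  locallyIntegrable_deriv : LocallyIntegrable g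
  integral_eq : ∀ χ : ℝ → ℝ, ContDiff ℝ ∞ χ → HasCompactSupport χ →
    ∫ x, deriv χ x • v x = -∫ x, χ x • g x

/-- `v ∈ H¹_loc(ℝ; F)`. Functions are not identified when they agree almost everywhere, but every
notion below depends on `v` up to almost everywhere equality only. -/
def MemH1loc {F : Type*} [NormedAddCommGroup F] [NormedSpace ℝ F] (v : ℝ → F) : Prop :=
  MemL2loc v ∧ ∃ g : ℝ → F, MemL2loc g ∧ IsWeakDeriv v g

open Classical in
/-- The weak derivative `v'` of `v`, unique up to almost everywhere equality
(and `0` if `v` has no weak derivative). -/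
def weakDeriv {F : Type*} [NormedAddCommGroup F] [NormedSpace ℝ F] (v : ℝ → F) : ℝ → F :=
  if h : ∃ g : ℝ → F, IsWeakDeriv v g then h.choose else 0

/-- The weak derivative does not depend on the choice. -/
theorem IsWeakDeriv.ae_eq_weakDeriv {F : Type*} [NormedAddCommGroup F] [NormedSpace ℝ F]
    [CompleteSpace F] {v g : ℝ → F} (h : IsWeakDeriv v g) : weakDeriv v =ᵐ[volume] g := by
  have hex : ∃ g : ℝ → F, IsWeakDeriv v g := ⟨g, h⟩
  have h' : IsWeakDeriv v (weakDeriv v) := by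
    rw [weakDeriv, dif_pos hex]
    exact hex.choose_spec
  refine ae_eq_of_integral_contDiff_smul_eq h'.locallyIntegrable_deriv
    h.locallyIntegrable_deriv fun χ hχ hχc => ?_
  exact neg_injective ((h'.integral_eq χ hχ hχc).symm.trans (h.integral_eq χ hχ hχc))

/-- Adding a constant does not change the weak derivative. -/
theorem IsWeakDeriv.add_const {φ g : ℝ → ℝ} (h : IsWeakDeriv φ g) (a : ℝ) :
    IsWeakDeriv (fun x => φ x + a) g where
  locallyIntegrable := h.locallyIntegrable.add (continuous_const.locallyIntegrable)
  locallyIntegrable_deriv := h.locallyIntegrable_deriv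
  integral_eq χ hχ hχc := by
    have hd : Continuous (deriv χ) := hχ.continuous_deriv (by simp)
    have h1 : Integrable fun x => deriv χ x • φ x :=
      h.locallyIntegrable.integrable_smul_left_of_hasCompactSupport hd hχc.deriv
    have h2 : Integrable (deriv χ) := hd.integrable_of_hasCompactSupport hχc.deriv
    have h3 : ∫ x, deriv χ x = 0 :=
      integral_eq_zero_of_hasDerivAt_of_integrable
        (fun x => (hχ.differentiable (by simp) x).hasDerivAt) h2
        (hχ.continuous.integrable_of_hasCompactSupport hχc)
    simp only [smul_add]
    rw [integral_add h1 (by simpa using h2.mul_const a), h.integral_eq χ hχ hχc]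
    simp only [smul_eq_mul, integral_mul_const, h3, zero_mul, add_zero]

/-! ### Energy and renormalized momentum -/

/-- The Ginzburg–Landau energy `E(v) = ½ ∫ |v'|² + ¼ ∫ (1 - |v|²)²`, with values in `[0, ∞]`. -/
def energy (v : ℝ → ℂ) : ℝ≥0∞ :=
  ∫⁻ x, ENNReal.ofReal ((1 / 2) * ‖weakDeriv v x‖ ^ 2 + (1 / 4) * (1 - ‖v x‖ ^ 2) ^ 2)

/-- `v = ρ exp(iφ)` with `ρ > 0` and `φ` real valued and continuous, `φ` in `H¹_loc(ℝ)`. -/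
structure IsPolarForm (v : ℝ → ℂ) (ρ φ : ℝ → ℝ) : Prop where
  continuous_modulus : Continuous ρ
  modulus_pos : ∀ x, 0 < ρ x
  continuous_phase : Continuous φ
  phase_memH1loc : MemH1loc φ
  ae_eq : v =ᵐ[volume] fun x => (ρ x : ℂ) * Complex.exp (Complex.I * (φ x : ℂ))

open Classical in
/-- The renormalized momentum `p(v) = ½ ∫ (1 - ρ²) φ'`, where `v = ρ exp(iφ)`
(and `0` if `v` has no polar form). -/
def renormalizedMomentum (v : ℝ → ℂ) : ℝ :=
  if h : ∃ P : (ℝ → ℝ) × (ℝ → ℝ), IsPolarForm v P.1 P.2 then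
    (1 / 2) * ∫ x, (1 - h.choose.1 x ^ 2) * weakDeriv h.choose.2 x
  else 0

/-- Two polar forms of the same function have the same modulus, and phases that differ by
a constant. -/
theorem IsPolarForm.unique {v : ℝ → ℂ} {ρ φ ρ' φ' : ℝ → ℝ}
    (h : IsPolarForm v ρ φ) (h' : IsPolarForm v ρ' φ') :
    ρ = ρ' ∧ ∃ a : ℝ, ∀ x, φ' x = φ x + a := by
  have hc : Continuous fun x => (ρ x : ℂ) * Complex.exp (Complex.I * (φ x : ℂ)) := by
    have := h.continuous_modulus
    have := h.continuous_phase
    fun_prop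
  have hc' : Continuous fun x => (ρ' x : ℂ) * Complex.exp (Complex.I * (φ' x : ℂ)) := by
    have := h'.continuous_modulus
    have := h'.continuous_phase
    fun_prop
  have heq := (Continuous.ae_eq_iff_eq volume hc hc').1 (h.ae_eq.symm.trans h'.ae_eq)
  have hρ : ∀ x, ρ x = ρ' x := by
    intro x
    have h1 := congrArg norm (congrFun heq x)
    simp only [norm_mul, mul_comm Complex.I, Complex.norm_exp_ofReal_mul_I, mul_one,
      Complex.norm_real, Real.norm_eq_abs, abs_of_pos (h.modulus_pos x),
      abs_of_pos (h'.modulus_pos x)] at h1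
    exact h1
  refine ⟨funext hρ, ?_⟩
  have hn : ∀ x, ∃ n : ℤ, φ' x = φ x + n * (2 * Real.pi) := by
    intro x
    have h1 := congrFun heq x
    simp only [hρ x] at h1
    have h2 := mul_left_cancel₀ (Complex.ofReal_ne_zero.2 (h'.modulus_pos x).ne') h1
    obtain ⟨n, hn⟩ := Complex.exp_eq_exp_iff_exists_int.1 h2.symm
    refine ⟨n, ?_⟩
    have h3 := congrArg Complex.im hn
    simpa using h3
  choose n hn using hn
  have hcont : Continuous fun x => (n x : ℝ) := by
    have h4 : (fun x => (n x : ℝ)) = fun x => (φ' x - φ x) / (2 * Real.pi) := by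
      funext x
      rw [hn x]
      field_simp
      ring
    rw [h4]
    exact (h'.continuous_phase.sub h.continuous_phase).div_const _
  have hcontZ : Continuous n := Int.isClosedEmbedding_coe_real.isEmbedding.continuous_iff.2 hcont
  refine ⟨n 0 * (2 * Real.pi), fun x => ?_⟩
  rw [hn x, PreconnectedSpace.constant inferInstance hcontZ (x := x) (y := 0)]

/-- The renormalized momentum may be computed with any polar form. -/
theorem IsPolarForm.renormalizedMomentum_eq {v : ℝ → ℂ} {ρ φ : ℝ → ℝ}
    (h : IsPolarForm v ρ φ) :
    renormalizedMomentum v = (1 / 2) * ∫ x, (1 - ρ x ^ 2) * weakDeriv φ x := by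
  have hex : ∃ P : (ℝ → ℝ) × (ℝ → ℝ), IsPolarForm v P.1 P.2 := ⟨(ρ, φ), h⟩
  rw [renormalizedMomentum, dif_pos hex]
  obtain ⟨hρ, a, ha⟩ := h.unique hex.choose_spec
  obtain ⟨g, -, hg⟩ := h.phase_memH1loc.2
  have hg' : IsWeakDeriv hex.choose.2 g := by
    rw [show hex.choose.2 = fun x => φ x + a from funext ha]
    exact hg.add_const a
  congr 1
  refine integral_congr_ae ?_
  filter_upwards [hg.ae_eq_weakDeriv, hg'.ae_eq_weakDeriv] with x h1 h2
  rw [h1, h2, hρ]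

/-- The admissible set `X_𝔭`. -/
def admissible (𝔭 : ℝ) : Set (ℝ → ℂ) :=
  {v | MemH1loc v ∧ energy v < ENNReal.ofReal (2 * √2 / 3) ∧ renormalizedMomentum v = 𝔭}

/-- The minimal energy `E_min(𝔭) = inf {E(v) : v ∈ X_𝔭}`. -/
def minEnergy (𝔭 : ℝ) : ℝ≥0∞ :=
  ⨅ v ∈ admissible 𝔭, energy v

/-- `v` solves the minimization problem: it lies in `X_𝔭` and attains the infimum. -/
def IsMinimizer (𝔭 : ℝ) (v : ℝ → ℂ) : Prop :=
  v ∈ admissible 𝔭 ∧ energy v = minEnergy 𝔭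

/-! ### Dark solitons -/

/-- The dark soliton of speed `c`. -/
def soliton (c : ℝ) (x : ℝ) : ℂ :=
  ((√((2 - c ^ 2) / 2) * Real.tanh (√(2 - c ^ 2) / 2 * x) : ℝ) : ℂ)
    - Complex.I * ((c / √2 : ℝ) : ℂ)

/-- `c` is a speed in `(0, √2)` associated with the momentum `𝔭`. -/
def IsSpeed (𝔭 c : ℝ) : Prop :=
  0 < c ∧ c < √2 ∧
    𝔭 = Real.pi / 2 - Real.arctan (c / √(2 - c ^ 2)) - c / 2 * √(2 - c ^ 2)

end

end GP

namespace GP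
noncomputable section

open Filter Topology Set

/-! ### Absolutely continuous functions and weak derivatives -/

/-! Write `v = ρ exp(iφ)` and let `m = min ρ`. Subtracting `√2 m` times the momentum from the energy
completes a square in `φ'`, and what remains is `ρ'²/2 + slope(ρ)²/2`, with a slope that depends
only on `m` and vanishes at `m` and at `1` (`polarDensity_sub_momentum`). The multiplier comes from
the minimal modulus of `v` itself: since `ρ ≥ m`, the remainder is nonnegative. By the
Modica–Mortola trick on each side of a minimum point, and since `ρ → 1` at `±∞`, the energy equals
`√2 m p + 2 ∫_m^1 slope` plus the integral of a sum of squares, the defect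
(`IsPolarPair.energy_eq`).

With `m = cos s` the lower bound is the explicit function `angleBound p s`, whose derivative is `√2
sin s (angleMomentum s - p)`. As `angleMomentum` is increasing, the bound has a strict minimum at
the angle `t` with `angleMomentum t = p` (`angleBound_lt`), and the minimum `(2√2/3) sin³ t` is the
energy of the dark soliton of momentum `p`. The case `ρ ≥ 1` corresponds to the endpoint `s = 0`.

In the equality case `m = cos t` and the defect vanishes: `φ'` is a function of `ρ`, and `ρ' = ±
slope(ρ)`. The slope behaves like a square root at `m`, so this equation would let `ρ` rest at `m`
on an interval. Outside such a plateau `√(ρ² - m²)` solves the Riccati equation of `tanh`; the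
plateau itself would add momentum, which the constraint forbids
(`IsPolarPair.eq_modulus_of_energy_eq`). -/

/-- `f` is locally absolutely continuous, with derivative `g` almost everywhere. -/
structure HasACDeriv (f g : ℝ → ℝ) : Prop where
  ac : ∀ a b, AbsolutelyContinuousOnInterval f a b
  ae_hasDerivAt : ∀ᵐ x, HasDerivAt f (g x) x

namespace HasACDeriv

variable {f g f₁ g₁ : ℝ → ℝ}

theorem continuous (h : HasACDeriv f g) : Continuous f := by
  rw [continuous_iff_continuousAt]
  intro x
  have h1 := (h.ac (x - 1) (x + 1)).continuousOn
  rw [uIcc_of_le (by linarith)] at h1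
  exact h1.continuousAt (Icc_mem_nhds (by linarith) (by linarith))

theorem deriv_ae_eq (h : HasACDeriv f g) : deriv f =ᵐ[volume] g := by
  filter_upwards [h.ae_hasDerivAt] with x hx using hx.deriv

theorem intervalIntegrable (h : HasACDeriv f g) (a b : ℝ) :
    IntervalIntegrable g volume a b :=
  (h.ac a b).intervalIntegrable_deriv.congr_ae (ae_restrict_of_ae h.deriv_ae_eq)

theorem integral_eq (h : HasACDeriv f g) (a b : ℝ) : ∫ x in a..b, g x = f b - f a := by
  rw [← (h.ac a b).integral_deriv_eq_sub]
  refine intervalIntegral.integral_congr_ae ?_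
  filter_upwards [h.deriv_ae_eq] with x hx _ using hx.symm

theorem locallyIntegrable (h : HasACDeriv f g) : LocallyIntegrable g := by
  rw [locallyIntegrable_iff]
  intro K hK
  obtain ⟨a, b, hab⟩ : ∃ a b, K ⊆ Ioc a b := by
    obtain ⟨r, hr⟩ := hK.isBounded.subset_closedBall 0
    refine ⟨-r - 1, r, fun x hx => ?_⟩
    have := hr hx
    rw [Real.closedBall_eq_Icc] at this
    constructor <;> linarith [this.1, this.2]
  exact (h.intervalIntegrable a b).1.mono_set hab

theorem congr (h : HasACDeriv f g) (hg : g =ᵐ[volume] g₁) : HasACDeriv f g₁ :=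
  ⟨h.ac, by filter_upwards [h.ae_hasDerivAt, hg] with x h1 h2; rwa [← h2]⟩

theorem add (h : HasACDeriv f g) (h₁ : HasACDeriv f₁ g₁) :
    HasACDeriv (fun x => f x + f₁ x) (fun x => g x + g₁ x) :=
  ⟨fun a b => (h.ac a b).fun_add (h₁.ac a b), by
    filter_upwards [h.ae_hasDerivAt, h₁.ae_hasDerivAt] with x h1 h2 using h1.add h2⟩

theorem mul (h : HasACDeriv f g) (h₁ : HasACDeriv f₁ g₁) :
    HasACDeriv (fun x => f x * f₁ x) (fun x => g x * f₁ x + f x * g₁ x) :=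
  ⟨fun a b => (h.ac a b).fun_mul (h₁.ac a b), by
    filter_upwards [h.ae_hasDerivAt, h₁.ae_hasDerivAt] with x h1 h2 using h1.mul h2⟩

end HasACDeriv

/-- The composition of a function which is Lipschitz on the image of an interval with an absolutely
continuous function is absolutely continuous. -/
theorem _root_.LipschitzOnWith.comp_absolutelyContinuousOnInterval {f Ψ : ℝ → ℝ} {a b : ℝ}
    {K : NNReal} {s : Set ℝ} (hΨ : LipschitzOnWith K Ψ s) (hs : MapsTo f (uIcc a b) s)
    (hf : AbsolutelyContinuousOnInterval f a b) :
    AbsolutelyContinuousOnInterval (fun x => Ψ (f x)) a b := by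
  have h0 : Tendsto (fun E : ℕ × (ℕ → ℝ × ℝ) =>
      (K : ℝ) * ∑ i ∈ Finset.range E.1, dist (f (E.2 i).1) (f (E.2 i).2))
      (AbsolutelyContinuousOnInterval.totalLengthFilter ⊓
        𝓟 (AbsolutelyContinuousOnInterval.disjWithin a b)) (𝓝 0) := by
    simpa using Tendsto.const_mul (K : ℝ) hf
  refine squeeze_zero' (Eventually.of_forall fun E => Finset.sum_nonneg fun i _ => dist_nonneg) ?_ h0
  filter_upwards [mem_inf_of_right (mem_principal_self _)] with E hE
  rw [Finset.mul_sum]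
  exact Finset.sum_le_sum fun i hi =>
    hΨ.dist_le_mul _ (hs (hE.1 i hi).1) _ (hs (hE.1 i hi).2)

namespace HasACDeriv

variable {f g : ℝ → ℝ}

/-- On a bounded interval `f` takes values in a compact interval, where a `C¹` function is
Lipschitz. -/
theorem comp (h : HasACDeriv f g) {Ψ : ℝ → ℝ} (hΨ : ContDiff ℝ 1 Ψ) :
    HasACDeriv (fun x => Ψ (f x)) (fun x => deriv Ψ (f x) * g x) := by
  refine ⟨fun a b => ?_, ?_⟩
  · obtain ⟨C, hC⟩ := (h.ac a b).exists_bound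
    obtain ⟨K, hK⟩ := (hΨ.contDiffOn (s := Icc (-C) C)).exists_lipschitzOnWith (by decide)
      (convex_Icc _ _) isCompact_Icc
    exact hK.comp_absolutelyContinuousOnInterval (fun x hx => abs_le.1 (hC x hx)) (h.ac a b)
  · filter_upwards [h.ae_hasDerivAt] with x hx
    exact ((hΨ.differentiable (by simp) _).hasDerivAt).comp x hx

theorem of_contDiff (h : ContDiff ℝ 1 f) : HasACDeriv f (deriv f) :=
  ⟨fun _ _ => h.contDiffOn.absolutelyContinuousOnInterval,
    Eventually.of_forall fun x => (h.differentiable (by simp) x).hasDerivAt⟩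

theorem of_integral (hg : LocallyIntegrable g) (C a : ℝ) :
    HasACDeriv (fun x => C + ∫ t in a..x, g t) g := by
  have hi : ∀ a b, IntervalIntegrable g volume a b := fun a b =>
    intervalIntegrable_iff.2
      ((hg.integrableOn_isCompact isCompact_uIcc).mono_set uIoc_subset_uIcc)
  refine ⟨fun b c => ?_, ?_⟩
  · have h1 : AbsolutelyContinuousOnInterval (fun x => ∫ t in a..x, g t) b c := by
      -- The absolute continuity of a primitive is applied on an interval enlarged to contain the
      -- base point `a`.
      refine ((hi (min a (min b c)) (max a (max b c))).absolutelyContinuousOnInterval_intervalIntegral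
        (c := a) ?_).mono ?_
      · rw [uIcc_of_le (by simp)]; simp
      · rw [uIcc_of_le (a := min a _) (by simp)]
        exact Icc_subset_Icc (by simp) (by simp)
    have h2 : AbsolutelyContinuousOnInterval (fun _ : ℝ => C) b c :=
      (contDiff_const (n := 1)).contDiffOn.absolutelyContinuousOnInterval
    exact h2.fun_add h1
  · filter_upwards [_root_.LocallyIntegrable.ae_hasDerivAt_integral hg] with x hx
    exact (hx a).const_add C

/-- Integration by parts: `χ f` is absolutely continuous and vanishes at `±R`, so its derivative
integrates to zero. -/
theorem isWeakDeriv (h : HasACDeriv f g) : IsWeakDeriv f g where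
  locallyIntegrable := h.continuous.locallyIntegrable
  locallyIntegrable_deriv := h.locallyIntegrable
  integral_eq χ hχ hχc := by
    have hd : Continuous (deriv χ) := hχ.continuous_deriv (by simp)
    have i1 : Integrable fun x => deriv χ x • f x :=
      h.continuous.locallyIntegrable.integrable_smul_left_of_hasCompactSupport hd hχc.deriv
    have i2 : Integrable fun x => χ x • g x :=
      h.locallyIntegrable.integrable_smul_left_of_hasCompactSupport hχ.continuous hχc
    have hm := (of_contDiff (hχ.of_le (by simp))).mul h
    obtain ⟨R, hR⟩ := hχc.isBounded.subset_ball 0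
    have hz : ∀ x, x ∉ Ioo (-R) R → χ x = 0 := fun x hx =>
      image_eq_zero_of_notMem_tsupport fun hx' => hx (by simpa [Real.ball_eq_Ioo] using hR hx')
    have hz' : ∀ x, x ∉ Ioo (-R) R → deriv χ x = 0 := fun x hx =>
      image_eq_zero_of_notMem_tsupport fun hx' =>
        hx (by simpa [Real.ball_eq_Ioo] using hR (tsupport_deriv_subset hx'))
    have h1 : ∫ x, (deriv χ x * f x + χ x * g x) = 0 := by
      rw [← intervalIntegral.integral_eq_integral_of_support_subset (a := -R) (b := R),
        hm.integral_eq, hz R (by simp), hz (-R) (by simp)]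
      · simp
      · intro x hx
        by_contra hx'
        have hx'' : x ∉ Ioo (-R) R := fun h => hx' (Ioo_subset_Ioc_self h)
        simp [hz x hx'', hz' x hx''] at hx
    simp only [smul_eq_mul] at *
    rw [integral_add i1 i2] at h1
    linarith

end HasACDeriv

/-- A smooth compactly supported function with zero mean is the derivative of a smooth compactly
supported function. -/
theorem exists_deriv_eq_of_integral_eq_zero {ψ : ℝ → ℝ} (hψ : ContDiff ℝ ∞ ψ)
    (hψc : HasCompactSupport ψ) (h0 : ∫ x, ψ x = 0) :
    ∃ χ : ℝ → ℝ, ContDiff ℝ ∞ χ ∧ HasCompactSupport χ ∧ deriv χ = ψ := by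
  obtain ⟨R, hR⟩ := hψc.isBounded.subset_ball 0
  have hz : ∀ x, x ∉ Ioo (-R) R → ψ x = 0 := fun x hx =>
    image_eq_zero_of_notMem_tsupport fun hx' => hx (by simpa [Real.ball_eq_Ioo] using hR hx')
  have hd : ∀ x, HasDerivAt (fun x => ∫ t in (-R)..x, ψ t) (ψ x) x := fun x =>
    hψ.continuous.integral_hasStrictDerivAt _ _ |>.hasDerivAt
  have hd' : deriv (fun x => ∫ t in (-R)..x, ψ t) = ψ := funext fun x => (hd x).deriv
  refine ⟨fun x => ∫ t in (-R)..x, ψ t, ?_, ?_, hd'⟩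
  · rw [contDiff_infty_iff_deriv, hd']
    exact ⟨fun x => (hd x).differentiableAt, hψ⟩
  · refine HasCompactSupport.intro (isCompact_Icc (a := -R) (b := R)) fun x hx => ?_
    rcases lt_or_ge x (-R) with hx1 | hx1
    · rw [intervalIntegral.integral_congr (g := fun _ => 0)]
      · simp
      · intro t ht
        rw [uIcc_of_ge hx1.le] at ht
        exact hz t fun h => by linarith [h.1, ht.2]
    · have hx2 : R < x := by
        by_contra hx2
        exact hx ⟨hx1, not_lt.1 hx2⟩
      rw [intervalIntegral.integral_eq_integral_of_support_subset, h0]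
      intro t ht
      by_contra hx'
      exact ht (hz t fun h => hx' ⟨h.1, (h.2.trans hx2).le⟩)

/-- A locally integrable function with zero weak derivative is constant. -/
theorem IsWeakDeriv.ae_eq_const {f : ℝ → ℝ} (h : IsWeakDeriv f 0) :
    ∃ C : ℝ, f =ᵐ[volume] fun _ => C := by
  -- Fix a bump `θ` of integral one. Then `ψ - (∫ ψ) θ` has zero mean, hence is the derivative of a
  -- test function, and testing with it gives `∫ ψ f = (∫ ψ) ∫ θ f`. The constant is therefore `∫ θ
  -- f`.
  let β : ContDiffBump (0 : ℝ) := ⟨1, 2, by norm_num, by norm_num⟩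
  let θ : ℝ → ℝ := β.normed volume
  have hθ : ContDiff ℝ ∞ θ := β.contDiff_normed
  have hθc : HasCompactSupport θ := β.hasCompactSupport_normed
  have hθ1 : ∫ x, θ x = 1 := β.integral_normed
  have iθ : Integrable θ := hθ.continuous.integrable_of_hasCompactSupport hθc
  have iθf : Integrable fun x => θ x • f x :=
    h.locallyIntegrable.integrable_smul_left_of_hasCompactSupport hθ.continuous hθc
  refine ⟨∫ x, θ x * f x, ?_⟩
  refine ae_eq_of_integral_contDiff_smul_eq h.locallyIntegrable
    continuous_const.locallyIntegrable fun ψ hψ hψc => ?_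
  have iψ : Integrable ψ := hψ.continuous.integrable_of_hasCompactSupport hψc
  have iψf : Integrable fun x => ψ x • f x :=
    h.locallyIntegrable.integrable_smul_left_of_hasCompactSupport hψ.continuous hψc
  obtain ⟨χ, hχ, hχc, hχd⟩ := exists_deriv_eq_of_integral_eq_zero
    (ψ := fun x => ψ x - (∫ y, ψ y) * θ x) (hψ.sub (contDiff_const.mul hθ))
    (hψc.sub hθc.mul_left) (by
      rw [integral_sub iψ (iθ.const_mul _), integral_const_mul, hθ1]; ring)
  have h1 := h.integral_eq χ hχ hχc
  rw [hχd] at h1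
  simp only [smul_eq_mul, Pi.zero_apply, mul_zero, integral_zero, neg_zero] at *
  have h2 : ∀ x, (ψ x - (∫ y, ψ y) * θ x) * f x = ψ x * f x - (∫ y, ψ y) * (θ x * f x) :=
    fun x => by ring
  simp only [h2] at h1
  rw [integral_sub iψf (iθf.const_mul _), integral_const_mul] at h1
  rw [integral_mul_const]
  linarith

/-- A function with a weak derivative has an absolutely continuous representative. -/
theorem IsWeakDeriv.exists_hasACDeriv {f g : ℝ → ℝ} (h : IsWeakDeriv f g) :
    ∃ F : ℝ → ℝ, HasACDeriv F g ∧ f =ᵐ[volume] F := by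
  have hF := HasACDeriv.of_integral h.locallyIntegrable_deriv 0 0
  set F : ℝ → ℝ := fun x => 0 + ∫ t in (0 : ℝ)..x, g t
  have hw := hF.isWeakDeriv
  have hsub : IsWeakDeriv (fun x => f x - F x) 0 := by
    refine ⟨h.locallyIntegrable.sub hw.locallyIntegrable, locallyIntegrable_zero,
      fun χ hχ hχc => ?_⟩
    have hd : Continuous (deriv χ) := hχ.continuous_deriv (by simp)
    simp only [smul_sub]
    rw [integral_sub, h.integral_eq χ hχ hχc, hw.integral_eq χ hχ hχc]
    · simp
    · exact h.locallyIntegrable.integrable_smul_left_of_hasCompactSupport hd hχc.deriv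
    · exact hw.locallyIntegrable.integrable_smul_left_of_hasCompactSupport hd hχc.deriv
  obtain ⟨C, hC⟩ := hsub.ae_eq_const
  refine ⟨fun x => C + ∫ t in (0 : ℝ)..x, g t,
    HasACDeriv.of_integral h.locallyIntegrable_deriv C 0, ?_⟩
  filter_upwards [hC] with x hx
  simp only [F, zero_add] at hx
  linarith

/-- Bounded real linear maps commute with weak derivatives. -/
theorem IsWeakDeriv.clm_comp {E F : Type*} [NormedAddCommGroup E] [NormedSpace ℝ E]
    [CompleteSpace E] [NormedAddCommGroup F] [NormedSpace ℝ F] [CompleteSpace F]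
    {v g : ℝ → E} (h : IsWeakDeriv v g) (T : E →L[ℝ] F) :
    IsWeakDeriv (fun x => T (v x)) (fun x => T (g x)) := by
  have hT : ∀ {u : ℝ → E}, LocallyIntegrable u → LocallyIntegrable fun x => T (u x) :=
    fun {u} hu x => (hu x).imp fun s hs => ⟨hs.1, T.integrable_comp hs.2⟩
  refine ⟨hT h.locallyIntegrable, hT h.locallyIntegrable_deriv, fun χ hχ hχc => ?_⟩
  have hd : Continuous (deriv χ) := hχ.continuous_deriv (by simp)
  have i1 := h.locallyIntegrable.integrable_smul_left_of_hasCompactSupport hd hχc.deriv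
  have i2 := h.locallyIntegrable_deriv.integrable_smul_left_of_hasCompactSupport
    hχ.continuous hχc
  have := congrArg T (h.integral_eq χ hχ hχc)
  rw [map_neg, ← T.integral_comp_comm i1, ← T.integral_comp_comm i2] at this
  simpa only [map_smul] using this

theorem IsWeakDeriv.congr_ae {F : Type*} [NormedAddCommGroup F] [NormedSpace ℝ F]
    {v v₁ g : ℝ → F} (h : IsWeakDeriv v g) (hv : v =ᵐ[volume] v₁) : IsWeakDeriv v₁ g := by
  refine ⟨fun x => (h.locallyIntegrable x).imp fun s hs =>
    ⟨hs.1, hs.2.congr (ae_restrict_of_ae hv)⟩, h.locallyIntegrable_deriv, fun χ hχ hχc => ?_⟩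
  rw [← h.integral_eq χ hχ hχc]
  refine integral_congr_ae ?_
  filter_upwards [hv] with x hx
  rw [hx]

/-- Continuously differentiable functions have their classical derivative as weak derivative. -/
theorem isWeakDeriv_of_hasDerivAt {F : Type*} [NormedAddCommGroup F] [NormedSpace ℝ F]
    {v g : ℝ → F} (h : ∀ x, HasDerivAt v (g x) x) (hg : Continuous g) : IsWeakDeriv v g := by
  have hv : Continuous v := continuous_iff_continuousAt.2 fun x => (h x).continuousAt
  refine ⟨hv.locallyIntegrable, hg.locallyIntegrable, fun χ hχ hχc => ?_⟩
  have hd : Continuous (deriv χ) := hχ.continuous_deriv (by simp)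
  have i0 := hv.locallyIntegrable.integrable_smul_left_of_hasCompactSupport hχ.continuous hχc
    (μ := volume)
  have i1 := hv.locallyIntegrable.integrable_smul_left_of_hasCompactSupport hd hχc.deriv
    (μ := volume)
  have i2 := hg.locallyIntegrable.integrable_smul_left_of_hasCompactSupport hχ.continuous hχc
    (μ := volume)
  have h3 := integral_eq_zero_of_hasDerivAt_of_integrable
    (fun x => ((hχ.differentiable (by simp) x).hasDerivAt).smul (h x)) (i2.add i1) i0
  have h4 := integral_add i2 i1
  rw [h3, add_comm] at h4
  exact eq_neg_of_add_eq_zero_left h4.symm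

theorem _root_.Continuous.memL2loc {F : Type*} [NormedAddCommGroup F] {v : ℝ → F}
    (hv : Continuous v) : MemL2loc v := fun K hK => by
  obtain ⟨C, hC⟩ := hK.exists_bound_of_continuousOn hv.continuousOn
  have : IsFiniteMeasure (volume.restrict K) := ⟨by simpa using hK.measure_lt_top⟩
  refine MemLp.of_bound hv.aestronglyMeasurable C ?_
  exact (ae_restrict_iff' hK.measurableSet).2 (Eventually.of_forall hC)

theorem memH1loc_of_hasDerivAt {F : Type*} [NormedAddCommGroup F] [NormedSpace ℝ F]
    {v w g : ℝ → F} (h : ∀ x, HasDerivAt w (g x) x) (hg : Continuous g)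
    (hv : v =ᵐ[volume] w) : MemH1loc v := by
  have hw : Continuous w := continuous_iff_continuousAt.2 fun x => (h x).continuousAt
  refine ⟨fun K hK => (memLp_congr_ae (ae_restrict_of_ae hv)).2 (hw.memL2loc K hK), g,
    hg.memL2loc, (isWeakDeriv_of_hasDerivAt h hg).congr_ae hv.symm⟩

/-! ### Dark solitons -/

theorem _root_.Real.hasDerivAt_tanh (x : ℝ) : HasDerivAt Real.tanh (1 - Real.tanh x ^ 2) x := by
  have h : HasDerivAt (fun x => Real.sinh x / Real.cosh x) _ x :=
    (Real.hasDerivAt_sinh x).div (Real.hasDerivAt_cosh x) (Real.cosh_pos x).ne'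
  have h0 : Real.tanh = fun x => Real.sinh x / Real.cosh x :=
    funext Real.tanh_eq_sinh_div_cosh
  rw [h0]
  convert h using 1
  have := (Real.cosh_pos x).ne'
  field_simp

theorem _root_.Real.tendsto_tanh_atTop : Tendsto Real.tanh atTop (𝓝 1) := by
  have h : Real.tanh = fun x => 1 - 2 / (Real.exp (2 * x) + 1) := by
    funext x
    rw [Real.tanh_eq, Real.exp_neg, two_mul, Real.exp_add]
    have := Real.exp_pos x
    field_simp
    ring
  rw [h]
  have h1 : Tendsto (fun x : ℝ => Real.exp (2 * x) + 1) atTop atTop :=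
    tendsto_atTop_add_const_right _ _
      (Real.tendsto_exp_atTop.comp (tendsto_id.const_mul_atTop (by norm_num)))
  simpa using (h1.const_div_atTop 2).const_sub 1

theorem _root_.Real.tendsto_tanh_atBot : Tendsto Real.tanh atBot (𝓝 (-1)) := by
  have h := (Real.tendsto_tanh_atTop.comp tendsto_neg_atBot_atTop).neg
  refine h.congr fun x => ?_
  simp

/-- A function with nonnegative derivative and limits at `±∞` has an integrable derivative. -/
theorem integrable_and_integral_eq_of_hasDerivAt_of_nonneg {f f' : ℝ → ℝ} {m n : ℝ}
    (hd : ∀ x, HasDerivAt f (f' x) x) (hc : Continuous f') (h0 : ∀ x, 0 ≤ f' x)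
    (hbot : Tendsto f atBot (𝓝 m)) (htop : Tendsto f atTop (𝓝 n)) :
    Integrable f' ∧ ∫ x, f' x = n - m := by
  have hi : Integrable f' := by
    refine integrable_of_intervalIntegral_norm_tendsto (n - m)
      (a := fun x : ℝ => -x) (b := fun x : ℝ => x) (l := atTop)
      (fun x => (hc.integrableOn_Icc).mono_set Ioc_subset_Icc_self)
      tendsto_neg_atTop_atBot tendsto_id ?_
    have h1 : ∀ x : ℝ, ∫ t in (-x)..x, ‖f' t‖ = f x - f (-x) := fun x => by
      simp_rw [Real.norm_of_nonneg (h0 _)]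
      exact intervalIntegral.integral_eq_sub_of_hasDerivAt (fun t _ => hd t)
        (hc.intervalIntegrable _ _)
    simp_rw [h1]
    exact htop.sub (hbot.comp tendsto_neg_atTop_atBot)
  exact ⟨hi, integral_of_hasDerivAt_of_tendsto hd hi hbot htop⟩

/-- The real part of the dark soliton of depth `k`. -/
def kink (k x : ℝ) : ℝ := k * Real.tanh (k / √2 * x)

/-- The modulus of the dark soliton of minimal modulus `m` and depth `k`. -/
def modulus (m k x : ℝ) : ℝ := √(kink k x ^ 2 + m ^ 2)

/-- The phase of the dark soliton of minimal modulus `m` and depth `k`. -/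
def phase (m k x : ℝ) : ℝ := Real.arctan (kink k x / m) - Real.pi / 2

/-- The dark soliton of minimal modulus `m` and depth `k`. -/
def darkSoliton (m k x : ℝ) : ℂ := (kink k x : ℂ) - Complex.I * (m : ℂ)

section Kink

variable {m k : ℝ}

theorem kink_zero : kink k 0 = 0 := by simp [kink]

theorem kink_neg (x : ℝ) : kink k (-x) = -kink k x := by simp [kink]

/-- This Riccati equation is used in place of `tanh` from here on: it gives the primitives of the
energy and momentum densities, and it identifies the minimizers. -/
theorem hasDerivAt_kink (k x : ℝ) : HasDerivAt (kink k) ((k ^ 2 - kink k x ^ 2) / √2) x := by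
  have h := ((Real.hasDerivAt_tanh (k / √2 * x)).comp x
    ((hasDerivAt_id x).const_mul (k / √2))).const_mul k
  refine h.congr_deriv ?_
  simp only [kink]
  ring

theorem continuous_kink : Continuous (kink k) :=
  continuous_iff_continuousAt.2 fun x => (hasDerivAt_kink k x).continuousAt

theorem kink_nonneg (hk : 0 < k) {x : ℝ} (hx : 0 ≤ x) : 0 ≤ kink k x := by
  refine mul_nonneg hk.le ?_
  rw [Real.tanh_eq_sinh_div_cosh]
  exact div_nonneg (Real.sinh_nonneg_iff.2 (by positivity)) (Real.cosh_pos _).le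

theorem tendsto_kink_atTop (hk : 0 < k) : Tendsto (kink k) atTop (𝓝 k) := by
  have h := (Real.tendsto_tanh_atTop.comp
    (tendsto_id.const_mul_atTop (show 0 < k / √2 by positivity))).const_mul k
  rwa [mul_one] at h

theorem tendsto_kink_atBot (hk : 0 < k) : Tendsto (kink k) atBot (𝓝 (-k)) := by
  have h := (Real.tendsto_tanh_atBot.comp
    (tendsto_id.const_mul_atBot (show 0 < k / √2 by positivity))).const_mul k
  rwa [mul_neg, mul_one] at h

theorem modulus_sq (m k x : ℝ) : modulus m k x ^ 2 = kink k x ^ 2 + m ^ 2 :=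
  Real.sq_sqrt (by positivity)

theorem modulus_pos (hm : 0 < m) (x : ℝ) : 0 < modulus m k x :=
  Real.sqrt_pos.2 (by positivity)

theorem continuous_modulus : Continuous (modulus m k) := by
  have := continuous_kink (k := k)
  unfold modulus
  fun_prop

theorem one_sub_modulus_sq (h : m ^ 2 + k ^ 2 = 1) (x : ℝ) :
    1 - modulus m k x ^ 2 = k ^ 2 - kink k x ^ 2 := by
  rw [modulus_sq]; linarith

/-- The derivative is put in terms of the modulus because in this form it is the value of `φ'` that
annihilates the square completed in `polarDensity_sub_momentum`. -/
theorem hasDerivAt_phase (h : m ^ 2 + k ^ 2 = 1) (hm : 0 < m) (x : ℝ) :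
    HasDerivAt (phase m k) (m * (1 - modulus m k x ^ 2) / (√2 * modulus m k x ^ 2)) x := by
  have h1 := (((hasDerivAt_kink k x).div_const m).arctan).sub_const (Real.pi / 2)
  refine h1.congr_deriv ?_
  rw [one_sub_modulus_sq h, modulus_sq]
  field_simp
  ring

theorem continuous_phase_deriv (hm : 0 < m) :
    Continuous fun x => m * (1 - modulus m k x ^ 2) / (√2 * modulus m k x ^ 2) := by
  have := continuous_modulus (m := m) (k := k)
  refine Continuous.div (by fun_prop) (by fun_prop) fun x => ?_
  have := modulus_pos (k := k) hm x
  positivity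

/-- `kink - i m = -i (m + i kink)`: as `m > 0`, the second factor has argument `arctan (kink / m)`,
and `-i` accounts for the shift by `-π/2`. -/
theorem darkSoliton_eq (hm : 0 < m) (x : ℝ) :
    darkSoliton m k x =
      (modulus m k x : ℂ) * Complex.exp (Complex.I * (phase m k x : ℂ)) := by
  have hs : √(1 + (kink k x / m) ^ 2) = modulus m k x / m := by
    rw [modulus, eq_div_iff hm.ne', ← Real.sqrt_sq hm.le, ← Real.sqrt_mul (by positivity),
      Real.sqrt_sq hm.le]
    congr 1
    field_simp
    ring
  have hR := modulus_pos (k := k) hm x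
  have hc : Real.cos (phase m k x) = kink k x / modulus m k x := by
    rw [phase, Real.cos_sub_pi_div_two, Real.sin_arctan, hs]
    field_simp
  have hsn : Real.sin (phase m k x) = -(m / modulus m k x) := by
    rw [phase, Real.sin_sub_pi_div_two, Real.cos_arctan, hs]
    field_simp
  rw [mul_comm Complex.I, Complex.exp_mul_I, ← Complex.ofReal_cos, ← Complex.ofReal_sin, hc, hsn,
    darkSoliton]
  have : (modulus m k x : ℂ) ≠ 0 := by exact_mod_cast hR.ne'
  push_cast
  field_simp
  ring

/-- With `w` the kink, `w' = (k² - w²)/√2`, so `(k² w - w³/3)/√2` is a primitive. -/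
theorem integral_kink_energy (hk : 0 < k) :
    Integrable (fun x => (k ^ 2 - kink k x ^ 2) ^ 2 / 2) ∧
      ∫ x, (k ^ 2 - kink k x ^ 2) ^ 2 / 2 = 2 * √2 / 3 * k ^ 3 := by
  have hs : √2 * √2 = 2 := Real.mul_self_sqrt (by norm_num)
  have hlim : ∀ {l : Filter ℝ} {y : ℝ}, Tendsto (kink k) l (𝓝 y) →
      Tendsto (fun x => (k ^ 2 * kink k x - kink k x ^ 3 / 3) / √2) l
        (𝓝 ((k ^ 2 * y - y ^ 3 / 3) / √2)) := fun h =>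
    ((h.const_mul _).sub ((h.pow 3).div_const _)).div_const _
  have h := integrable_and_integral_eq_of_hasDerivAt_of_nonneg
    (f' := fun x => (k ^ 2 - kink k x ^ 2) ^ 2 / 2) (fun x => ?_) ?_
    (fun x => by positivity) (hlim (tendsto_kink_atBot hk)) (hlim (tendsto_kink_atTop hk))
  · refine ⟨h.1, h.2.trans ?_⟩
    field_simp
    rw [show √2 ^ 2 = 2 by simp]
    ring
  · have h1 := hasDerivAt_kink k x
    refine (((h1.const_mul (k ^ 2)).sub ((h1.pow 3).div_const 3)).div_const (√2)).congr_deriv ?_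
    push_cast
    field_simp
    rw [show √2 ^ 2 = 2 by simp]
  · have := continuous_kink (k := k)
    fun_prop

/-- The primitive is `phase - m kink`: both derivatives carry the factor `m (1 - ρ²)/√2`, and `1/ρ²
- 1 = (1 - ρ²)/ρ²`. -/
theorem integral_modulus_momentum (h : m ^ 2 + k ^ 2 = 1) (hm : 0 < m) (hk : 0 < k) :
    Integrable (fun x => (1 - modulus m k x ^ 2) *
        (m * (1 - modulus m k x ^ 2) / (√2 * modulus m k x ^ 2))) ∧
      (1 / 2) * ∫ x, (1 - modulus m k x ^ 2) *
        (m * (1 - modulus m k x ^ 2) / (√2 * modulus m k x ^ 2)) =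
      Real.arctan (k / m) - m * k := by
  have hlim : ∀ {l : Filter ℝ} {y : ℝ}, Tendsto (kink k) l (𝓝 y) →
      Tendsto (fun x => phase m k x - m * kink k x) l
        (𝓝 (Real.arctan (y / m) - Real.pi / 2 - m * y)) := fun h =>
    ((((Real.continuous_arctan.tendsto _).comp (h.div_const m))).sub_const _).sub
      (h.const_mul _)
  have hi := integrable_and_integral_eq_of_hasDerivAt_of_nonneg
    (f' := fun x => (1 - modulus m k x ^ 2) *
        (m * (1 - modulus m k x ^ 2) / (√2 * modulus m k x ^ 2))) (fun x => ?_) ?_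
    (fun x => ?_) (hlim (tendsto_kink_atBot hk)) (hlim (tendsto_kink_atTop hk))
  · refine ⟨hi.1, ?_⟩
    rw [hi.2, neg_div, Real.arctan_neg]
    ring
  · refine ((hasDerivAt_phase h hm x).sub ((hasDerivAt_kink k x).const_mul m)).congr_deriv ?_
    rw [← one_sub_modulus_sq h]
    have := modulus_pos (k := k) hm x
    field_simp
  · have := continuous_modulus (m := m) (k := k)
    have := continuous_phase_deriv (k := k) hm
    fun_prop
  · have h1 := modulus_pos (k := k) hm x
    have h2 : (1 - modulus m k x ^ 2) * (m * (1 - modulus m k x ^ 2) / (√2 * modulus m k x ^ 2))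
      = m * (1 - modulus m k x ^ 2) ^ 2 / (√2 * modulus m k x ^ 2) := by ring
    rw [h2]
    positivity

theorem hasDerivAt_darkSoliton (m k α a x : ℝ) :
    HasDerivAt (fun x => Complex.exp (Complex.I * (α : ℂ)) * darkSoliton m k (x - a))
      (Complex.exp (Complex.I * (α : ℂ)) * (((k ^ 2 - kink k (x - a) ^ 2) / √2 : ℝ) : ℂ)) x := by
  have h1 : HasDerivAt (fun x => kink k (x - a)) ((k ^ 2 - kink k (x - a) ^ 2) / √2) x :=
    (hasDerivAt_kink k (x - a)).comp_sub_const x a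
  exact ((h1.ofReal_comp).sub_const _).const_mul _

variable {α a : ℝ} {v : ℝ → ℂ}

theorem norm_exp_mul_darkSoliton (m k α a x : ℝ) :
    ‖Complex.exp (Complex.I * (α : ℂ)) * darkSoliton m k (x - a)‖ ^ 2 =
      kink k (x - a) ^ 2 + m ^ 2 := by
  rw [norm_mul, mul_comm Complex.I, Complex.norm_exp_ofReal_mul_I, one_mul, darkSoliton,
    Complex.sq_norm, Complex.normSq_apply]
  simp
  ring

theorem continuous_deriv_darkSoliton (k α a : ℝ) : Continuous fun x : ℝ =>
    Complex.exp (Complex.I * (α : ℂ)) * (((k ^ 2 - kink k (x - a) ^ 2) / √2 : ℝ) : ℂ) := by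
  have := continuous_kink (k := k)
  fun_prop

theorem memH1loc_of_ae_eq_darkSoliton
    (hv : v =ᵐ[volume] fun x => Complex.exp (Complex.I * (α : ℂ)) * darkSoliton m k (x - a)) :
    MemH1loc v :=
  memH1loc_of_hasDerivAt (hasDerivAt_darkSoliton m k α a) (continuous_deriv_darkSoliton k α a) hv

theorem energy_of_ae_eq_darkSoliton (h : m ^ 2 + k ^ 2 = 1) (hk : 0 < k)
    (hv : v =ᵐ[volume] fun x => Complex.exp (Complex.I * (α : ℂ)) * darkSoliton m k (x - a)) :
    energy v = ENNReal.ofReal (2 * √2 / 3 * k ^ 3) := by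
  have hd := ((isWeakDeriv_of_hasDerivAt (hasDerivAt_darkSoliton m k α a)
    (continuous_deriv_darkSoliton k α a)).congr_ae hv.symm).ae_eq_weakDeriv
  -- Equipartition: the kinetic and potential parts both equal `(k² - w²)²/4`, where `w` is the
  -- translated kink.
  have h1 : energy v = ∫⁻ x, ENNReal.ofReal ((k ^ 2 - kink k (x - a) ^ 2) ^ 2 / 2) := by
    refine lintegral_congr_ae ?_
    filter_upwards [hv, hd] with x hx hdx
    rw [hdx, hx, norm_exp_mul_darkSoliton, norm_mul, mul_comm Complex.I,
      Complex.norm_exp_ofReal_mul_I, one_mul, Complex.norm_real, Real.norm_eq_abs, sq_abs, div_pow,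
      Real.sq_sqrt (by norm_num)]
    congr 1
    have : 1 - (kink k (x - a) ^ 2 + m ^ 2) = k ^ 2 - kink k (x - a) ^ 2 := by linarith
    rw [this]
    ring
  rw [h1, lintegral_sub_right_eq_self
    (fun x => ENNReal.ofReal ((k ^ 2 - kink k x ^ 2) ^ 2 / 2)) a,
    ← (integral_kink_energy hk).2, ofReal_integral_eq_lintegral_ofReal (integral_kink_energy hk).1]
  exact Eventually.of_forall fun x => by positivity

theorem isPolarForm_of_ae_eq_darkSoliton (h : m ^ 2 + k ^ 2 = 1) (hm : 0 < m)
    (hv : v =ᵐ[volume] fun x => Complex.exp (Complex.I * (α : ℂ)) * darkSoliton m k (x - a)) :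
    IsPolarForm v (fun x => modulus m k (x - a)) (fun x => phase m k (x - a) + α) := by
  have hd : ∀ x, HasDerivAt (fun x => phase m k (x - a) + α)
      (m * (1 - modulus m k (x - a) ^ 2) / (√2 * modulus m k (x - a) ^ 2)) x := fun x =>
    ((hasDerivAt_phase h hm (x - a)).comp_sub_const x a).add_const α
  have hc := (continuous_phase_deriv (k := k) hm).comp (continuous_id.sub (continuous_const (y := a)))
  refine ⟨continuous_modulus.comp (by fun_prop), fun x => modulus_pos hm _,
    continuous_iff_continuousAt.2 fun x => (hd x).continuousAt,
    memH1loc_of_hasDerivAt hd hc (ae_eq_refl _), ?_⟩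
  filter_upwards [hv] with x hx
  rw [hx, darkSoliton_eq hm]
  push_cast
  rw [mul_add, Complex.exp_add]
  ring

theorem renormalizedMomentum_of_ae_eq_darkSoliton (h : m ^ 2 + k ^ 2 = 1) (hm : 0 < m)
    (hk : 0 < k)
    (hv : v =ᵐ[volume] fun x => Complex.exp (Complex.I * (α : ℂ)) * darkSoliton m k (x - a)) :
    renormalizedMomentum v = Real.arctan (k / m) - m * k := by
  rw [(isPolarForm_of_ae_eq_darkSoliton h hm hv).renormalizedMomentum_eq,
    ← (integral_modulus_momentum h hm hk).2,
    ← integral_sub_right_eq_self (fun x => (1 - modulus m k x ^ 2) *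
        (m * (1 - modulus m k x ^ 2) / (√2 * modulus m k x ^ 2))) a]
  congr 1
  refine integral_congr_ae ?_
  have hd : ∀ x, HasDerivAt (fun x => phase m k (x - a) + α)
      (m * (1 - modulus m k (x - a) ^ 2) / (√2 * modulus m k (x - a) ^ 2)) x := fun x =>
    ((hasDerivAt_phase h hm (x - a)).comp_sub_const x a).add_const α
  have hc := (continuous_phase_deriv (k := k) hm).comp (continuous_id.sub (continuous_const (y := a)))
  filter_upwards [(isWeakDeriv_of_hasDerivAt hd hc).ae_eq_weakDeriv] with x hx
  rw [hx]

end Kink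

/-! ### Polar coordinates -/

theorem MemH1loc.isWeakDeriv_weakDeriv {F : Type*} [NormedAddCommGroup F] [NormedSpace ℝ F]
    {v : ℝ → F} (h : MemH1loc v) : IsWeakDeriv v (weakDeriv v) := by
  obtain ⟨-, g, -, hg⟩ := h
  have hex : ∃ g, IsWeakDeriv v g := ⟨g, hg⟩
  rw [weakDeriv, dif_pos hex]
  exact hex.choose_spec

/-- A continuous function in `H¹_loc` is absolutely continuous. -/
theorem IsWeakDeriv.hasACDeriv {f g : ℝ → ℝ} (h : IsWeakDeriv f g) (hf : Continuous f) :
    HasACDeriv f g := by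
  obtain ⟨F, hF, hfF⟩ := h.exists_hasACDeriv
  rwa [(Continuous.ae_eq_iff_eq volume hf hF.continuous).1 hfF]

/-- The energy density in polar coordinates, for modulus `ρ` with derivative `r` and phase with
derivative `q`. -/
def polarDensity (ρ r q : ℝ → ℝ) (x : ℝ) : ℝ :=
  (1 / 2) * (r x ^ 2 + ρ x ^ 2 * q x ^ 2) + (1 / 4) * (1 - ρ x ^ 2) ^ 2

/-- The real and imaginary parts of the continuous representative are absolutely continuous. The
modulus is recovered as `Re v cos φ + Im v sin φ`, which is a sum of products of absolutely
continuous functions. -/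
theorem IsPolarForm.exists_hasACDeriv_modulus {v : ℝ → ℂ} {ρ φ : ℝ → ℝ} (h : IsPolarForm v ρ φ)
    (hv : MemH1loc v) :
    HasACDeriv φ (weakDeriv φ) ∧ ∃ r : ℝ → ℝ, HasACDeriv ρ r ∧
      energy v = ∫⁻ x, ENNReal.ofReal (polarDensity ρ r (weakDeriv φ) x) := by
  have hw := hv.isWeakDeriv_weakDeriv
  have hφ : HasACDeriv φ (weakDeriv φ) :=
    h.phase_memH1loc.isWeakDeriv_weakDeriv.hasACDeriv h.continuous_phase
  refine ⟨hφ, ?_⟩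
  set q := weakDeriv φ
  set g := weakDeriv v
  have hρc := h.continuous_modulus
  have hφc := h.continuous_phase
  have hexp : ∀ x, (ρ x : ℂ) * Complex.exp (Complex.I * (φ x : ℂ)) =
      ((ρ x * Real.cos (φ x) : ℝ) : ℂ) + ((ρ x * Real.sin (φ x) : ℝ) : ℂ) * Complex.I := by
    intro x
    rw [mul_comm Complex.I, Complex.exp_mul_I, ← Complex.ofReal_cos, ← Complex.ofReal_sin]
    push_cast
    ring
  have h1 : HasACDeriv (fun x => ρ x * Real.cos (φ x)) (fun x => (g x).re) := by
    refine IsWeakDeriv.hasACDeriv ((hw.clm_comp Complex.reCLM).congr_ae ?_) (by fun_prop)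
    filter_upwards [h.ae_eq] with x hx
    rw [hx, hexp, Complex.reCLM_apply, Complex.add_re, Complex.re_ofReal_mul, Complex.ofReal_re]
    simp
  have h2 : HasACDeriv (fun x => ρ x * Real.sin (φ x)) (fun x => (g x).im) := by
    refine IsWeakDeriv.hasACDeriv ((hw.clm_comp Complex.imCLM).congr_ae ?_) (by fun_prop)
    filter_upwards [h.ae_eq] with x hx
    rw [hx, hexp, Complex.imCLM_apply, Complex.add_im, Complex.im_ofReal_mul, Complex.ofReal_im]
    simp
  have hcos := hφ.comp Real.contDiff_cos
  have hsin := hφ.comp Real.contDiff_sin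
  have h3 := (h1.mul hcos).add (h2.mul hsin)
  have hρ : (fun x => ρ x * Real.cos (φ x) * Real.cos (φ x) +
      ρ x * Real.sin (φ x) * Real.sin (φ x)) = ρ := by
    funext x
    linear_combination ρ x * Real.cos_sq_add_sin_sq (φ x)
  rw [hρ] at h3
  refine ⟨_, h3, lintegral_congr_ae ?_⟩
  filter_upwards [h.ae_eq, h3.ae_hasDerivAt, hφ.ae_hasDerivAt, h1.ae_hasDerivAt,
    h2.ae_hasDerivAt] with x hx hρx hφx h1x h2x
  set r := fun x => (g x).re * Real.cos (φ x) +
    ρ x * Real.cos (φ x) * (deriv Real.cos (φ x) * q x) +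
    ((g x).im * Real.sin (φ x) + ρ x * Real.sin (φ x) * (deriv Real.sin (φ x) * q x))
  have e1 : (g x).re = r x * Real.cos (φ x) + ρ x * (-Real.sin (φ x) * q x) :=
    h1x.unique (hρx.mul hφx.cos)
  have e2 : (g x).im = r x * Real.sin (φ x) + ρ x * (Real.cos (φ x) * q x) :=
    h2x.unique (hρx.mul hφx.sin)
  have e3 : ‖v x‖ ^ 2 = ρ x ^ 2 := by
    rw [hx, norm_mul, mul_comm Complex.I, Complex.norm_exp_ofReal_mul_I, mul_one,
      Complex.norm_real, Real.norm_eq_abs, sq_abs]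
  have e4 : ‖g x‖ ^ 2 = r x ^ 2 + ρ x ^ 2 * q x ^ 2 := by
    rw [Complex.sq_norm, Complex.normSq_apply, e1, e2]
    linear_combination (r x ^ 2 + ρ x ^ 2 * q x ^ 2) * Real.cos_sq_add_sin_sq (φ x)
  rw [e3, e4]
  rfl

/-- The modulus and the phase of a finite energy function without zeros, with well defined
momentum density. -/
structure IsPolarPair (ρ φ r q : ℝ → ℝ) : Prop where
  pos : ∀ x, 0 < ρ x
  hasACDeriv_modulus : HasACDeriv ρ r
  hasACDeriv_phase : HasACDeriv φ q
  integrable_energy : Integrable (polarDensity ρ r q)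
  integrable_momentum : Integrable fun x => (1 - ρ x ^ 2) * q x

theorem polarDensity_nonneg (ρ r q : ℝ → ℝ) (x : ℝ) : 0 ≤ polarDensity ρ r q x := by
  unfold polarDensity
  positivity

/-- A nonzero momentum excludes two default values: that of `renormalizedMomentum` when there is no
polar form, and that of the integral when the momentum density is not integrable. -/
theorem exists_isPolarPair {v : ℝ → ℂ} (hv : MemH1loc v) (hE : energy v < ⊤)
    (hp : renormalizedMomentum v ≠ 0) :
    ∃ ρ φ r q : ℝ → ℝ, IsPolarForm v ρ φ ∧ IsPolarPair ρ φ r q ∧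
      energy v = ENNReal.ofReal (∫ x, polarDensity ρ r q x) ∧
      renormalizedMomentum v = (1 / 2) * ∫ x, (1 - ρ x ^ 2) * q x := by
  by_cases hex : ∃ P : (ℝ → ℝ) × (ℝ → ℝ), IsPolarForm v P.1 P.2
  swap
  · exact absurd (by rw [renormalizedMomentum, dif_neg hex]) hp
  obtain ⟨⟨ρ, φ⟩, h⟩ := hex
  obtain ⟨hφ, r, hρ, he⟩ := h.exists_hasACDeriv_modulus hv
  have hm := h.renormalizedMomentum_eq
  have hmeas : AEStronglyMeasurable (polarDensity ρ r (weakDeriv φ)) volume := by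
    have h1 := hρ.locallyIntegrable.aestronglyMeasurable
    have h2 := hφ.locallyIntegrable.aestronglyMeasurable
    have h3 := hρ.continuous.aestronglyMeasurable (μ := volume)
    exact (((h1.pow 2).add ((h3.pow 2).mul (h2.pow 2))).const_mul _).add
      (((aestronglyMeasurable_const.sub (h3.pow 2)).pow 2).const_mul _)
  have hint : Integrable (polarDensity ρ r (weakDeriv φ)) := by
    rw [← lintegral_ofReal_ne_top_iff_integrable hmeas
      (Eventually.of_forall (polarDensity_nonneg _ _ _)), ← he]
    exact hE.ne
  refine ⟨ρ, φ, r, weakDeriv φ, h, ⟨h.modulus_pos, hρ, hφ, hint, ?_⟩, ?_, hm⟩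
  · by_contra hni
    exact hp (by rw [hm, integral_undef hni, mul_zero])
  · rw [he, ofReal_integral_eq_lintegral_ofReal hint
      (Eventually.of_forall (polarDensity_nonneg _ _ _))]

/-! ### Behaviour at infinity -/

theorem HasACDeriv.tendsto_integral_atTop {f g : ℝ → ℝ} (h : HasACDeriv f g) (hg : Integrable g)
    (z : ℝ) : Tendsto f atTop (𝓝 (f z + ∫ x in Ioi z, g x)) := by
  have h1 := (intervalIntegral_tendsto_integral_Ioi z hg.integrableOn tendsto_id).const_add (f z)
  refine h1.congr fun x => ?_
  rw [id, h.integral_eq]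
  ring

theorem HasACDeriv.tendsto_integral_atBot {f g : ℝ → ℝ} (h : HasACDeriv f g) (hg : Integrable g)
    (z : ℝ) : Tendsto f atBot (𝓝 (f z - ∫ x in Iic z, g x)) := by
  have h1 := (intervalIntegral_tendsto_integral_Iic z hg.integrableOn tendsto_id).const_sub (f z)
  refine h1.congr fun x => ?_
  rw [id, h.integral_eq]
  ring

/-- Integrability of `g` gives limits at `±∞`, and integrability of `f` forces them to vanish. -/
theorem HasACDeriv.tendsto_zero {f g : ℝ → ℝ} (h : HasACDeriv f g) (hf : Integrable f)
    (hg : Integrable g) : Tendsto f atTop (𝓝 0) ∧ Tendsto f atBot (𝓝 0) := by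
  have h1 := h.tendsto_integral_atTop hg 0
  have h2 := h.tendsto_integral_atBot hg 0
  constructor
  · rwa [IntegrableAtFilter.eq_zero_of_tendsto (hf.integrableAtFilter _) (fun s hs => ?_) h1] at h1
    obtain ⟨b, hb⟩ := mem_atTop_sets.1 hs
    rw [← top_le_iff, ← Real.volume_Ici (a := b)]
    exact measure_mono hb
  · rwa [IntegrableAtFilter.eq_zero_of_tendsto (hf.integrableAtFilter _) (fun s hs => ?_) h2] at h2
    obtain ⟨b, hb⟩ := mem_atBot_sets.1 hs
    rw [← top_le_iff, ← Real.volume_Iic (a := b)]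
    exact measure_mono hb

namespace IsPolarPair

variable {ρ φ r q : ℝ → ℝ}

/-- The function `B(y) = 2/3 - y + y³/3 = (1 - y)² (2 + y)/3` has derivative `-(1 - y²)`. The energy
density controls both `B(ρ)` and, by Young's inequality, `(B(ρ))'`, so `B(ρ) → 0`; and `(1 - ρ)² ≤
(3/2) B(ρ)`. -/
theorem tendsto_modulus (h : IsPolarPair ρ φ r q) :
    Tendsto ρ atTop (𝓝 1) ∧ Tendsto ρ atBot (𝓝 1) := by
  have hB : ContDiff ℝ 1 fun y : ℝ => 2 / 3 - y + y ^ 3 / 3 := by fun_prop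
  have hd : ∀ y : ℝ, deriv (fun y : ℝ => 2 / 3 - y + y ^ 3 / 3) y = -(1 - y ^ 2) := by
    intro y
    have h1 : HasDerivAt (fun y : ℝ => 2 / 3 - y + y ^ 3 / 3) _ y :=
      ((hasDerivAt_id y).const_sub (2 / 3)).add ((hasDerivAt_pow 3 y).div_const 3)
    rw [h1.deriv]
    push_cast
    ring
  have hac := h.hasACDeriv_modulus.comp hB
  simp only [hd] at hac
  have hρ := h.hasACDeriv_modulus.continuous
  have hr := h.hasACDeriv_modulus.locallyIntegrable.aestronglyMeasurable
  have i1 : Integrable fun x => 2 / 3 - ρ x + ρ x ^ 3 / 3 := by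
    refine (h.integrable_energy.const_mul 4).mono' (by fun_prop) (Eventually.of_forall fun x => ?_)
    have hx := h.pos x
    have e1 : 2 / 3 - ρ x + ρ x ^ 3 / 3 = (1 - ρ x) ^ 2 * (2 + ρ x) / 3 := by ring
    rw [Real.norm_of_nonneg (by rw [e1]; positivity), polarDensity, e1]
    have e2 : (1 - ρ x ^ 2) ^ 2 = (1 - ρ x) ^ 2 * (1 + ρ x) ^ 2 := by ring
    have e3 : (1 - ρ x) ^ 2 * (2 + ρ x) / 3 ≤ (1 - ρ x) ^ 2 * (1 + ρ x) ^ 2 := by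
      rw [mul_div_assoc]
      exact mul_le_mul_of_nonneg_left (by nlinarith) (sq_nonneg _)
    nlinarith [sq_nonneg (r x), sq_nonneg (ρ x * q x)]
  have i2 : Integrable fun x => -(1 - ρ x ^ 2) * r x := by
    refine (h.integrable_energy.const_mul 2).mono'
      ((by fun_prop : Continuous fun x => -(1 - ρ x ^ 2)).aestronglyMeasurable.mul hr)
      (Eventually.of_forall fun x => ?_)
    rw [Real.norm_eq_abs, abs_le, polarDensity]
    constructor <;> nlinarith [sq_nonneg (ρ x * q x), sq_nonneg (r x + (1 - ρ x ^ 2) / 2),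
      sq_nonneg (r x - (1 - ρ x ^ 2) / 2), sq_nonneg (1 - ρ x ^ 2)]
  have key : ∀ {l : Filter ℝ}, Tendsto (fun x => 2 / 3 - ρ x + ρ x ^ 3 / 3) l (𝓝 0) →
      Tendsto ρ l (𝓝 1) := by
    intro l hl
    have h1 : Tendsto (fun x => √(3 / 2 * (2 / 3 - ρ x + ρ x ^ 3 / 3))) l (𝓝 0) := by
      simpa using (hl.const_mul (3 / 2)).sqrt
    rw [tendsto_iff_norm_sub_tendsto_zero]
    refine squeeze_zero (fun _ => norm_nonneg _) (fun x => ?_) h1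
    rw [Real.norm_eq_abs]
    refine Real.abs_le_sqrt ?_
    have := h.pos x
    nlinarith [mul_nonneg this.le (sq_nonneg (1 - ρ x))]
  obtain ⟨ht, hb⟩ := hac.tendsto_zero i1 i2
  exact ⟨key ht, key hb⟩

/-- Either the modulus is at least one, or it has a minimum. -/
theorem exists_min_modulus (h : IsPolarPair ρ φ r q) :
    (∀ x, 1 ≤ ρ x) ∨ ∃ z, ρ z < 1 ∧ ∀ x, ρ z ≤ ρ x := by
  by_cases h1 : ∀ x, 1 ≤ ρ x
  · exact Or.inl h1
  right
  push Not at h1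
  obtain ⟨y, hy⟩ := h1
  have hev : ∀ᶠ x in cocompact ℝ, ρ y ≤ ρ x := by
    rw [cocompact_eq_atBot_atTop]
    exact eventually_sup.2 ⟨h.tendsto_modulus.2.eventually_const_le hy,
      h.tendsto_modulus.1.eventually_const_le hy⟩
  obtain ⟨z, hz⟩ := h.hasACDeriv_modulus.continuous.exists_forall_le' y hev
  exact ⟨z, (hz y).trans_lt hy, hz⟩

end IsPolarPair

/-! ### The lower bound for the energy -/

/-- The slope of the modulus of a dark soliton of minimal modulus `m`, as a function of the
modulus. -/
def slope (m y : ℝ) : ℝ := (1 - y ^ 2) * √(y ^ 2 - m ^ 2) / (√2 * max y m)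

/-- The primitive of the slope that vanishes at the minimal modulus. -/
def slopePrimitive (m y : ℝ) : ℝ := ∫ t in m..y, slope m t

/-- Having `max y m` in the denominator changes nothing for `y ≥ m` and makes the slope continuous
on the whole line, so that its primitive is `C¹` and can be composed with `ρ`. -/
theorem continuous_slope {m : ℝ} (hm : 0 < m) : Continuous (slope m) := by
  unfold slope
  refine Continuous.div (by fun_prop) (by fun_prop) fun y => ?_
  have : 0 < max y m := lt_max_of_lt_right hm
  positivity

theorem hasDerivAt_slopePrimitive {m : ℝ} (hm : 0 < m) (y : ℝ) :
    HasDerivAt (slopePrimitive m) (slope m y) y :=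
  ((continuous_slope hm).integral_hasStrictDerivAt _ _).hasDerivAt

theorem contDiff_slopePrimitive {m : ℝ} (hm : 0 < m) : ContDiff ℝ 1 (slopePrimitive m) := by
  rw [contDiff_one_iff_deriv]
  refine ⟨fun y => (hasDerivAt_slopePrimitive hm y).differentiableAt, ?_⟩
  rw [show deriv (slopePrimitive m) = slope m from
    funext fun y => (hasDerivAt_slopePrimitive hm y).deriv]
  exact continuous_slope hm

theorem slope_sq {m y : ℝ} (hm : 0 < m) (hy : m ≤ y) :
    slope m y ^ 2 = (1 - y ^ 2) ^ 2 * (y ^ 2 - m ^ 2) / (2 * y ^ 2) := by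
  rw [slope, max_eq_left hy, div_pow, mul_pow, mul_pow, Real.sq_sqrt (by nlinarith),
    Real.sq_sqrt (by norm_num)]

/-- The energy density minus the Lagrange multiplier times the momentum density is a sum of
squares. -/
theorem polarDensity_sub_momentum {m : ℝ} (hm : 0 < m) (ρ r q : ℝ → ℝ) {x : ℝ} (hx : m ≤ ρ x) :
    polarDensity ρ r q x - m / √2 * ((1 - ρ x ^ 2) * q x) =
      r x ^ 2 / 2 + (ρ x * q x - m * (1 - ρ x ^ 2) / (√2 * ρ x)) ^ 2 / 2 +
        slope m (ρ x) ^ 2 / 2 := by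
  have h0 : 0 < ρ x := hm.trans_le hx
  have hs : √2 ^ 2 = 2 := Real.sq_sqrt (by norm_num)
  have e : (ρ x * q x - m * (1 - ρ x ^ 2) / (√2 * ρ x)) ^ 2 =
      ρ x ^ 2 * q x ^ 2 - 2 * (m / √2 * ((1 - ρ x ^ 2) * q x)) +
        m ^ 2 * (1 - ρ x ^ 2) ^ 2 / (2 * ρ x ^ 2) := by
    rw [sub_sq, div_pow, mul_pow, mul_pow, mul_pow, hs]
    field_simp
  rw [slope_sq hm hx, e, polarDensity]
  field_simp
  ring

/-- The nonnegative defect density in the lower bound for the energy: minimality point `z`, minimal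
modulus `m`. -/
def defect (m z : ℝ) (ρ r q : ℝ → ℝ) (x : ℝ) : ℝ :=
  (ρ x * q x - m * (1 - ρ x ^ 2) / (√2 * ρ x)) ^ 2 / 2 +
    (r x - (if x ≤ z then -1 else 1) * slope m (ρ x)) ^ 2 / 2

theorem defect_nonneg (m z : ℝ) (ρ r q : ℝ → ℝ) (x : ℝ) : 0 ≤ defect m z ρ r q x := by
  unfold defect
  positivity

namespace IsPolarPair

variable {ρ φ r q : ℝ → ℝ}

/-- This is the identity `polarDensity_sub_momentum` with `m = 1`, all of whose terms are
nonnegative. -/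
theorem energy_ge_of_one_le (h : IsPolarPair ρ φ r q) (h1 : ∀ x, 1 ≤ ρ x) :
    √2 * ((1 / 2) * ∫ x, (1 - ρ x ^ 2) * q x) ≤ ∫ x, polarDensity ρ r q x := by
  have h2 : 0 ≤ ∫ x, (polarDensity ρ r q x - 1 / √2 * ((1 - ρ x ^ 2) * q x)) := by
    refine integral_nonneg fun x => ?_
    simp only [polarDensity_sub_momentum one_pos ρ r q (h1 x), Pi.zero_apply]
    positivity
  rw [integral_sub h.integrable_energy (h.integrable_momentum.const_mul _),
    integral_const_mul] at h2
  have h3 : √2 * ((1 / 2) * ∫ x, (1 - ρ x ^ 2) * q x) =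
      1 / √2 * ∫ x, (1 - ρ x ^ 2) * q x := by
    field_simp
    rw [Real.sq_sqrt (by norm_num)]
  linarith

/-- With `σ = -1` up to `z` and `σ = 1` after it, `r²/2 + slope²/2 = σ slope r + (r - σ slope)²/2`.
The product `slope r` is the derivative of `slopePrimitive m ∘ ρ`, which is `0` at `z` and tends to
`slopePrimitive m 1` at both ends. -/
theorem energy_eq (h : IsPolarPair ρ φ r q) {z : ℝ} (hz : ∀ x, ρ z ≤ ρ x) :
    Integrable (defect (ρ z) z ρ r q) ∧
    ∫ x, polarDensity ρ r q x = √2 * ρ z * ((1 / 2) * ∫ x, (1 - ρ x ^ 2) * q x) +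
      2 * slopePrimitive (ρ z) 1 + ∫ x, defect (ρ z) z ρ r q x := by
  obtain ⟨m, hm⟩ : ∃ m, m = ρ z := ⟨_, rfl⟩
  rw [← hm] at hz ⊢
  have m0 : 0 < m := hm ▸ h.pos z
  have hac := h.hasACDeriv_modulus.comp (contDiff_slopePrimitive m0)
  simp only [(hasDerivAt_slopePrimitive m0 _).deriv] at hac
  have iK := h.integrable_energy.sub (h.integrable_momentum.const_mul (m / √2))
  -- By Young's inequality `|slope r|` is at most the sum of squares, which is integrable.
  have iF : Integrable fun x => slope m (ρ x) * r x := by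
    refine iK.mono' hac.locallyIntegrable.aestronglyMeasurable (Eventually.of_forall fun x => ?_)
    simp only [Pi.sub_apply]
    rw [polarDensity_sub_momentum m0 ρ r q (hz x), Real.norm_eq_abs, abs_le]
    constructor <;> nlinarith [sq_nonneg (r x + slope m (ρ x)), sq_nonneg (r x - slope m (ρ x)),
      sq_nonneg (ρ x * q x - m * (1 - ρ x ^ 2) / (√2 * ρ x))]
  have hcont : Continuous (slopePrimitive m) := (contDiff_slopePrimitive m0).continuous
  have hzero : slopePrimitive m (ρ z) = 0 := by simp [slopePrimitive, hm]
  have I1 : ∫ x in Ioi z, slope m (ρ x) * r x = slopePrimitive m 1 := by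
    have := tendsto_nhds_unique (hac.tendsto_integral_atTop iF z)
      ((hcont.tendsto _).comp h.tendsto_modulus.1)
    rwa [hzero, zero_add] at this
  have I2 : ∫ x in Iic z, slope m (ρ x) * r x = -slopePrimitive m 1 := by
    have := tendsto_nhds_unique (hac.tendsto_integral_atBot iF z)
      ((hcont.tendsto _).comp h.tendsto_modulus.2)
    rw [hzero] at this
    linarith
  have iG1 : IntegrableOn (fun x => (if x ≤ z then (-1 : ℝ) else 1) * (slope m (ρ x) * r x))
      (Iic z) :=
    iF.neg.integrableOn.congr_fun (fun x hx => by simp [mem_Iic.1 hx]) measurableSet_Iic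
  have iG2 : IntegrableOn (fun x => (if x ≤ z then (-1 : ℝ) else 1) * (slope m (ρ x) * r x))
      (Ioi z) :=
    iF.integrableOn.congr_fun (fun x hx => by simp [mem_Ioi.1 hx]) measurableSet_Ioi
  have iG : Integrable fun x => (if x ≤ z then (-1 : ℝ) else 1) * (slope m (ρ x) * r x) := by
    rw [← integrableOn_univ, ← Iic_union_Ioi (a := z)]
    exact iG1.union iG2
  have I3 : ∫ x, (if x ≤ z then (-1 : ℝ) else 1) * (slope m (ρ x) * r x) =
      2 * slopePrimitive m 1 := by
    rw [← setIntegral_univ, ← Iic_union_Ioi (a := z),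
      setIntegral_union (Iic_disjoint_Ioi le_rfl) measurableSet_Ioi iG1 iG2,
      setIntegral_congr_fun measurableSet_Iic (g := fun x => -(slope m (ρ x) * r x))
        (fun x hx => by simp [mem_Iic.1 hx]),
      setIntegral_congr_fun measurableSet_Ioi (g := fun x => slope m (ρ x) * r x)
        (fun x hx => by simp [mem_Ioi.1 hx]), integral_neg, I1, I2]
    ring
  have hD : defect m z ρ r q = fun x => (polarDensity ρ r q x -
      m / √2 * ((1 - ρ x ^ 2) * q x)) -
        (if x ≤ z then (-1 : ℝ) else 1) * (slope m (ρ x) * r x) := by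
    funext x
    rw [polarDensity_sub_momentum m0 ρ r q (hz x), defect]
    split_ifs <;> ring
  have iD : Integrable (defect m z ρ r q) := by
    rw [hD]
    exact iK.sub iG
  refine ⟨iD, ?_⟩
  have I4 : ∫ x, defect m z ρ r q x = (∫ x, polarDensity ρ r q x -
      m / √2 * ((1 - ρ x ^ 2) * q x)) - 2 * slopePrimitive m 1 := by
    rw [hD, ← I3]
    exact integral_sub iK iG
  rw [integral_sub h.integrable_energy (h.integrable_momentum.const_mul _),
    integral_const_mul] at I4
  have h3 : √2 * m * ((1 / 2) * ∫ x, (1 - ρ x ^ 2) * q x) =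
      m / √2 * ∫ x, (1 - ρ x ^ 2) * q x := by
    field_simp
    rw [Real.sq_sqrt (by norm_num)]
  linarith

end IsPolarPair

/-- In the variable `w = √(y² - m²)`, where `y dy = w dw`, the integrand becomes `(1 - m²/(w² + m²)
- w²)/√2`. The root is not differentiable at `y = m`, so the derivative is computed on the open
interval only. -/
theorem slopePrimitive_one {m k : ℝ} (hm : 0 < m) (hk : 0 < k) (h : m ^ 2 + k ^ 2 = 1) :
    slopePrimitive m 1 = √2 * (k / 2 - m / 2 * Real.arctan (k / m) - k ^ 3 / 6) := by
  have hm1 : m < 1 := by nlinarith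
  have hs : √2 ^ 2 = 2 := Real.sq_sqrt (by norm_num)
  have hw1 : √((1 : ℝ) ^ 2 - m ^ 2) = k := by
    rw [show (1 : ℝ) ^ 2 - m ^ 2 = k ^ 2 by linarith, Real.sqrt_sq hk.le]
  rw [slopePrimitive, intervalIntegral.integral_eq_sub_of_hasDerivAt_of_le hm1.le
    (f := fun y => √2 * (√(y ^ 2 - m ^ 2) / 2 - m / 2 * Real.arctan (√(y ^ 2 - m ^ 2) / m) -
      √(y ^ 2 - m ^ 2) ^ 3 / 6)) (by fun_prop) (fun y hy => ?_)
      ((continuous_slope hm).intervalIntegrable _ _)]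
  · simp only [hw1, sub_self, Real.sqrt_zero]
    simp
  · have hy0 : 0 < y := hm.trans hy.1
    have hpos : 0 < y ^ 2 - m ^ 2 := by nlinarith [hy.1]
    have hw : HasDerivAt (fun y => √(y ^ 2 - m ^ 2)) _ y :=
      ((hasDerivAt_pow 2 y).sub_const (m ^ 2)).sqrt hpos.ne'
    have hH := ((((hw.div_const 2).sub (((hw.div_const m).arctan).const_mul (m / 2))).sub
      ((hw.pow 3).div_const 6)).const_mul (√2))
    refine hH.congr_deriv ?_
    rw [slope, max_eq_left hy.1.le]
    obtain ⟨w, hw'⟩ : ∃ w, w = √(y ^ 2 - m ^ 2) := ⟨_, rfl⟩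
    have hw0 : 0 < w := hw' ▸ Real.sqrt_pos.2 hpos
    have hw2 : w ^ 2 = y ^ 2 - m ^ 2 := hw' ▸ Real.sq_sqrt hpos.le
    rw [← hw']
    have e1 : 1 + (w / m) ^ 2 = y ^ 2 / m ^ 2 := by
      rw [div_pow, hw2]
      field_simp
      ring
    rw [e1]
    push_cast
    field_simp
    rw [hs]
    have hm2 : m ^ 2 = y ^ 2 - w ^ 2 := by linarith
    rw [hm2]
    ring

/-! ### Speeds and angles -/

/-- The momentum of the dark soliton of minimal modulus `cos t`. -/
def angleMomentum (t : ℝ) : ℝ := t - Real.sin t * Real.cos t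

/-- The lower bound for the energy of functions of momentum `p` and minimal modulus `cos t`. -/
def angleBound (p t : ℝ) : ℝ :=
  √2 * (Real.cos t * (p - t) + Real.sin t - Real.sin t ^ 3 / 3)

theorem continuous_angleMomentum : Continuous angleMomentum := by
  unfold angleMomentum; fun_prop

theorem hasDerivAt_angleMomentum (t : ℝ) :
    HasDerivAt angleMomentum (2 * Real.sin t ^ 2) t := by
  refine ((hasDerivAt_id t).sub ((Real.hasDerivAt_sin t).mul (Real.hasDerivAt_cos t))).congr_deriv ?_
  linear_combination -Real.sin_sq_add_cos_sq t

theorem strictMonoOn_angleMomentum : StrictMonoOn angleMomentum (Icc 0 (Real.pi / 2)) := by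
  refine strictMonoOn_of_deriv_pos (convex_Icc _ _) continuous_angleMomentum.continuousOn
    fun t ht => ?_
  rw [interior_Icc] at ht
  rw [(hasDerivAt_angleMomentum t).deriv]
  have := Real.sin_pos_of_pos_of_lt_pi ht.1 (by linarith [ht.2, Real.pi_pos])
  positivity

theorem exists_angle {p : ℝ} (h0 : 0 < p) (h1 : p < Real.pi / 2) :
    ∃ t ∈ Ioo 0 (Real.pi / 2), angleMomentum t = p := by
  have h := intermediate_value_Ioo (by positivity : (0 : ℝ) ≤ Real.pi / 2)
    continuous_angleMomentum.continuousOn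
  exact h ⟨by simpa [angleMomentum] using h0, by simpa [angleMomentum] using h1⟩

/-- The factor `angleMomentum t - p` shows that the interior critical points of the bound are the
angles of momentum `p`. -/
theorem hasDerivAt_angleBound (p t : ℝ) :
    HasDerivAt (angleBound p) (√2 * Real.sin t * (angleMomentum t - p)) t := by
  have h := ((((Real.hasDerivAt_cos t).mul ((hasDerivAt_id t).const_sub p)).add
    (Real.hasDerivAt_sin t)).sub (((Real.hasDerivAt_sin t).pow 3).div_const 3)).const_mul (√2)
  refine h.congr_deriv ?_
  simp only [angleMomentum, id]
  push_cast
  ring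

theorem continuous_angleBound (p : ℝ) : Continuous (angleBound p) := by
  unfold angleBound; fun_prop

/-- The lower bound is minimal exactly at the angle of momentum `p`. -/
theorem angleBound_lt {t s : ℝ} (ht : t ∈ Ioo 0 (Real.pi / 2)) (hs : s ∈ Icc 0 (Real.pi / 2))
    (hne : s ≠ t) : angleBound (angleMomentum t) t < angleBound (angleMomentum t) s := by
  have ht' : t ∈ Icc 0 (Real.pi / 2) := Ioo_subset_Icc_self ht
  rcases lt_or_gt_of_ne hne with h | h
  · have hm : StrictAntiOn (angleBound (angleMomentum t)) (Icc 0 t) := by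
      refine strictAntiOn_of_deriv_neg (convex_Icc _ _) (continuous_angleBound _).continuousOn
        fun x hx => ?_
      rw [interior_Icc] at hx
      rw [(hasDerivAt_angleBound _ x).deriv]
      have h1 := Real.sin_pos_of_pos_of_lt_pi hx.1 (by linarith [hx.2, ht.2, Real.pi_pos])
      have h2 := strictMonoOn_angleMomentum ⟨hx.1.le, (hx.2.trans ht.2).le⟩ ht' hx.2
      exact mul_neg_of_pos_of_neg (by positivity) (by linarith)
    exact hm ⟨hs.1, h.le⟩ ⟨ht.1.le, le_rfl⟩ h
  · have hm : StrictMonoOn (angleBound (angleMomentum t)) (Icc t (Real.pi / 2)) := by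
      refine strictMonoOn_of_deriv_pos (convex_Icc _ _) (continuous_angleBound _).continuousOn
        fun x hx => ?_
      rw [interior_Icc] at hx
      rw [(hasDerivAt_angleBound _ x).deriv]
      have h1 := Real.sin_pos_of_pos_of_lt_pi (ht.1.trans hx.1) (by linarith [hx.2, Real.pi_pos])
      have h2 := strictMonoOn_angleMomentum ht' ⟨(ht.1.trans hx.1).le, hx.2.le⟩ hx.1
      exact mul_pos (by positivity) (by linarith)
    exact hm ⟨le_rfl, ht.2.le⟩ ⟨h.le, hs.2⟩ h

theorem angleBound_angleMomentum (t : ℝ) :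
    angleBound (angleMomentum t) t = 2 * √2 / 3 * Real.sin t ^ 3 := by
  rw [angleBound, angleMomentum]
  linear_combination √2 * Real.sin t * (-Real.sin_sq_add_cos_sq t)

theorem sqrt_two_sub_sq_cos {t : ℝ} (h : 0 ≤ Real.sin t) :
    √(2 - (√2 * Real.cos t) ^ 2) = √2 * Real.sin t := by
  rw [mul_pow, Real.sq_sqrt (by norm_num), show 2 - 2 * Real.cos t ^ 2 = 2 * Real.sin t ^ 2 by
    linear_combination 2 * -Real.sin_sq_add_cos_sq t, Real.sqrt_mul (by norm_num),
    Real.sqrt_sq h]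

theorem arctan_sin_div_cos {t : ℝ} (ht : t ∈ Ioo 0 (Real.pi / 2)) :
    Real.arctan (Real.sin t / Real.cos t) = t := by
  rw [← Real.tan_eq_sin_div_cos]
  exact Real.arctan_tan (by linarith [ht.1, Real.pi_pos]) ht.2

theorem sin_cos_pos {t : ℝ} (ht : t ∈ Ioo 0 (Real.pi / 2)) : 0 < Real.sin t ∧ 0 < Real.cos t :=
  ⟨Real.sin_pos_of_pos_of_lt_pi ht.1 (by linarith [ht.2, Real.pi_pos]),
    Real.cos_pos_of_mem_Ioo ⟨by linarith [ht.1, Real.pi_pos], ht.2⟩⟩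

/-- Under `c = √2 cos t` one has `√(2 - c²) = √2 sin t`, and `π/2 - arctan (cot t) = t`. -/
theorem isSpeed_iff {p c : ℝ} :
    IsSpeed p c ↔ ∃ t ∈ Ioo 0 (Real.pi / 2), c = √2 * Real.cos t ∧ p = angleMomentum t := by
  have hs2 : (0 : ℝ) < √2 := by positivity
  have key : ∀ t ∈ Ioo 0 (Real.pi / 2), Real.pi / 2 -
      Real.arctan (√2 * Real.cos t / √(2 - (√2 * Real.cos t) ^ 2)) -
        √2 * Real.cos t / 2 * √(2 - (√2 * Real.cos t) ^ 2) = angleMomentum t := by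
    intro t ht
    obtain ⟨h1, h2⟩ := sin_cos_pos ht
    rw [sqrt_two_sub_sq_cos h1.le, mul_div_mul_left _ _ hs2.ne', ← inv_div (Real.sin t),
      Real.arctan_inv_of_pos (by positivity), arctan_sin_div_cos ht, angleMomentum]
    have : √2 ^ 2 = 2 := Real.sq_sqrt (by norm_num)
    linear_combination -(Real.cos t * Real.sin t / 2) * this
  constructor
  · rintro ⟨h0, h1, h2⟩
    have h3 : c / √2 < 1 := (div_lt_one hs2).2 h1
    have h4 : 0 < c / √2 := by positivity
    have ht : Real.arccos (c / √2) ∈ Ioo 0 (Real.pi / 2) :=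
      ⟨Real.arccos_pos.2 h3, Real.arccos_lt_pi_div_two.2 h4⟩
    have hc : c = √2 * Real.cos (Real.arccos (c / √2)) := by
      rw [Real.cos_arccos (by linarith) h3.le]
      field_simp
    refine ⟨_, ht, hc, ?_⟩
    rw [h2, ← key _ ht, ← hc]
  · rintro ⟨t, ht, rfl, rfl⟩
    obtain ⟨h1, h2⟩ := sin_cos_pos ht
    have h3 : Real.cos t < 1 := by nlinarith [Real.sin_sq_add_cos_sq t]
    exact ⟨by positivity, by nlinarith, (key t ht).symm⟩

theorem existsUnique_isSpeed {p : ℝ} (h0 : 0 < p) (h1 : p < Real.pi / 2) :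
    ∃! c, IsSpeed p c := by
  obtain ⟨t, ht, rfl⟩ := exists_angle h0 h1
  refine ⟨√2 * Real.cos t, isSpeed_iff.2 ⟨t, ht, rfl, rfl⟩, fun c hc => ?_⟩
  obtain ⟨s, hs, rfl, hst⟩ := isSpeed_iff.1 hc
  rw [strictMonoOn_angleMomentum.injOn (Ioo_subset_Icc_self hs) (Ioo_subset_Icc_self ht) hst.symm]

theorem soliton_eq_darkSoliton {t : ℝ} (ht : t ∈ Ioo 0 (Real.pi / 2)) :
    soliton (√2 * Real.cos t) = darkSoliton (Real.cos t) (Real.sin t) := by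
  have hs := (sin_cos_pos ht).1
  have hs2 : √2 ^ 2 = 2 := Real.sq_sqrt (by norm_num)
  funext x
  rw [soliton, darkSoliton, kink, sqrt_two_sub_sq_cos hs.le, mul_pow, hs2,
    show (2 - 2 * Real.cos t ^ 2) / 2 = Real.sin t ^ 2 by
      linear_combination -Real.sin_sq_add_cos_sq t, Real.sqrt_sq hs.le,
    mul_div_cancel_left₀ _ (by positivity : √2 ≠ 0),
    show √2 * Real.sin t / 2 = Real.sin t / √2 by field_simp; rw [hs2]]

/-! ### The lower bound in terms of the momentum -/

namespace IsPolarPair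

variable {ρ φ r q : ℝ → ℝ} {t : ℝ}

theorem angleBound_le (h : IsPolarPair ρ φ r q) {z p : ℝ} (hz : ∀ x, ρ z ≤ ρ x) (hz1 : ρ z < 1)
    (hp : (1 / 2) * ∫ x, (1 - ρ x ^ 2) * q x = p) :
    ∃ s ∈ Ioo 0 (Real.pi / 2), ρ z = Real.cos s ∧
      ∫ x, polarDensity ρ r q x = angleBound p s + ∫ x, defect (ρ z) z ρ r q x := by
  have h0 := h.pos z
  have hs : Real.arccos (ρ z) ∈ Ioo 0 (Real.pi / 2) :=
    ⟨Real.arccos_pos.2 hz1, Real.arccos_lt_pi_div_two.2 h0⟩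
  have hc := (Real.cos_arccos (by linarith : -1 ≤ ρ z) hz1.le).symm
  refine ⟨_, hs, hc, ?_⟩
  obtain ⟨h1, h2⟩ := sin_cos_pos hs
  rw [(h.energy_eq hz).2, hp]
  set s := Real.arccos (ρ z)
  rw [hc, slopePrimitive_one h2 h1 (by rw [add_comm]; exact Real.sin_sq_add_cos_sq s),
    arctan_sin_div_cos hs, angleBound]
  ring

/-- The bound at the angle of the minimal modulus, or at the angle `0` if `ρ ≥ 1`, strictly exceeds
its value at `t` unless the two angles agree. -/
theorem energy_ge (h : IsPolarPair ρ φ r q) (ht : t ∈ Ioo 0 (Real.pi / 2))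
    (hp : (1 / 2) * ∫ x, (1 - ρ x ^ 2) * q x = angleMomentum t) :
    2 * √2 / 3 * Real.sin t ^ 3 ≤ ∫ x, polarDensity ρ r q x ∧
      (∫ x, polarDensity ρ r q x = 2 * √2 / 3 * Real.sin t ^ 3 →
        ∃ z, ρ z = Real.cos t ∧ ∀ x, ρ z ≤ ρ x) := by
  rw [← angleBound_angleMomentum]
  rcases h.exists_min_modulus with h1 | ⟨z, hz1, hz⟩
  · have h2 := h.energy_ge_of_one_le h1
    have h3 := angleBound_lt ht (s := 0) ⟨le_rfl, by positivity⟩ ht.1.ne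
    have h4 : angleBound (angleMomentum t) 0 = √2 * angleMomentum t := by simp [angleBound]
    rw [hp] at h2
    exact ⟨by linarith, fun h5 => by linarith⟩
  · obtain ⟨s, hs, hzs, hE⟩ := h.angleBound_le hz hz1 hp
    have hD : 0 ≤ ∫ x, defect (ρ z) z ρ r q x := integral_nonneg (defect_nonneg _ _ _ _ _)
    by_cases hst : s = t
    · subst hst
      exact ⟨by linarith, fun _ => ⟨z, hzs, hz⟩⟩
    · have h3 := angleBound_lt ht (Ioo_subset_Icc_self hs) hst
      exact ⟨by linarith, fun h5 => by linarith⟩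

/-- In the equality case, the modulus and the phase satisfy the equations of the dark soliton. -/
theorem ae_eq_of_energy_eq (h : IsPolarPair ρ φ r q) (ht : t ∈ Ioo 0 (Real.pi / 2))
    (hp : (1 / 2) * ∫ x, (1 - ρ x ^ 2) * q x = angleMomentum t)
    (hE : ∫ x, polarDensity ρ r q x = 2 * √2 / 3 * Real.sin t ^ 3) {z : ℝ}
    (hzt : ρ z = Real.cos t) (hz : ∀ x, ρ z ≤ ρ x) :
    (∀ᵐ x, r x = (if x ≤ z then -1 else 1) * slope (Real.cos t) (ρ x)) ∧
      ∀ᵐ x, q x = Real.cos t * (1 - ρ x ^ 2) / (√2 * ρ x ^ 2) := by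
  obtain ⟨hs, hc⟩ := sin_cos_pos ht
  have hz1 : ρ z < 1 := by rw [hzt]; nlinarith [Real.sin_sq_add_cos_sq t]
  obtain ⟨s, hsI, hzs, hEs⟩ := h.angleBound_le hz hz1 hp
  have hst : s = t := Real.injOn_cos ⟨hsI.1.le, by linarith [hsI.2, Real.pi_pos]⟩
    ⟨ht.1.le, by linarith [ht.2, Real.pi_pos]⟩ (hzs.symm.trans hzt)
  rw [hst, angleBound_angleMomentum, hE] at hEs
  have h0 : ∫ x, defect (ρ z) z ρ r q x = 0 := by linarith
  rw [integral_eq_zero_iff_of_nonneg (defect_nonneg _ _ _ _ _) (h.energy_eq hz).1, hzt] at h0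
  have h1 : ∀ᵐ x, (ρ x * q x - Real.cos t * (1 - ρ x ^ 2) / (√2 * ρ x)) = 0 ∧
      r x - (if x ≤ z then -1 else 1) * slope (Real.cos t) (ρ x) = 0 := by
    filter_upwards [h0] with x hx
    simp only [defect, Pi.zero_apply] at hx
    constructor <;> rw [← sq_eq_zero_iff] <;>
    nlinarith [sq_nonneg (ρ x * q x - Real.cos t * (1 - ρ x ^ 2) / (√2 * ρ x)),
      sq_nonneg (r x - (if x ≤ z then -1 else 1) * slope (Real.cos t) (ρ x))]
  refine ⟨h1.mono fun x hx => sub_eq_zero.1 hx.2, h1.mono fun x hx => ?_⟩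
  have h2 := hx.1
  have h3 := h.pos x
  field_simp at h2 ⊢
  linarith

end IsPolarPair

/-! ### Rigidity -/

/-- A solution of the modulus equation which leaves the minimal modulus at `z` is the modulus of
a dark soliton. -/
theorem eq_modulus_of_hasDerivAt {f : ℝ → ℝ} {m k z : ℝ} (hm : 0 < m) (hk : 0 < k)
    (h : m ^ 2 + k ^ 2 = 1) (hf : Continuous f) (hz : f z = m) (hgt : ∀ x, z < x → m < f x)
    (hd : ∀ x, z < x → HasDerivAt f (slope m (f x)) x) {x : ℝ} (hx : z ≤ x) :
    f x = modulus m k (x - z) := by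
  have hwk : Continuous (kink k) := continuous_kink
  -- The slope is not Lipschitz at `m`, but `w = √(f² - m²)` solves the same Riccati equation as the
  -- kink. The square of their difference has derivative `-2 (w - kink)² (w + kink)/√2 ≤ 0` and
  -- starts from `0`.
  have hanti : AntitoneOn (fun x => (√(f x ^ 2 - m ^ 2) - kink k (x - z)) ^ 2) (Ici z) := by
    refine antitoneOn_of_hasDerivWithinAt_nonpos (convex_Ici z) (by fun_prop)
      (f' := fun x => 2 * (√(f x ^ 2 - m ^ 2) - kink k (x - z)) *
        ((1 - f x ^ 2) / √2 - (k ^ 2 - kink k (x - z) ^ 2) / √2))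
      (fun x hx => ?_) (fun x hx => ?_) <;> rw [interior_Ici] at hx
    · have hfx := hgt x hx
      have hpos : 0 < f x ^ 2 - m ^ 2 := by nlinarith
      have hw := Real.sqrt_pos.2 hpos
      have h1 := (((hd x hx).pow 2).sub_const (m ^ 2)).sqrt hpos.ne'
      have h2 : HasDerivAt (fun x => kink k (x - z)) ((k ^ 2 - kink k (x - z) ^ 2) / √2) x :=
        (hasDerivAt_kink k (x - z)).comp_sub_const x z
      refine (((h1.sub h2).pow 2).congr_deriv ?_).hasDerivWithinAt
      have h3 : 0 < f x := hm.trans hfx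
      have e : (2 : ℕ) * f x ^ (2 - 1) * slope m (f x) / (2 * √(f x ^ 2 - m ^ 2)) =
          (1 - f x ^ 2) / √2 := by
        rw [slope, max_eq_left hfx.le]
        push_cast
        field_simp
      simp only [Pi.sub_apply, Pi.pow_apply]
      rw [e]
      push_cast
      ring
    · have hfx := hgt x hx
      have hpos : 0 ≤ f x ^ 2 - m ^ 2 := by nlinarith
      have hw := Real.sq_sqrt hpos
      have h2 := kink_nonneg hk (sub_nonneg.2 (le_of_lt hx))
      set w := √(f x ^ 2 - m ^ 2)
      have hw0 : 0 ≤ w := Real.sqrt_nonneg _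
      have e : 2 * (w - kink k (x - z)) *
          ((1 - f x ^ 2) / √2 - (k ^ 2 - kink k (x - z) ^ 2) / √2) =
          -(2 * (w - kink k (x - z)) ^ 2 * (w + kink k (x - z)) / √2) := by
        rw [show f x ^ 2 = w ^ 2 + m ^ 2 by linarith, show m ^ 2 = 1 - k ^ 2 by linarith]
        ring
      rw [e, neg_nonpos]
      positivity
  have h1 := hanti (mem_Ici.2 le_rfl) (mem_Ici.2 hx) hx
  simp only [hz, sub_self, Real.sqrt_zero, kink_zero] at h1
  have h2 : √(f x ^ 2 - m ^ 2) = kink k (x - z) := by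
    have : (√(f x ^ 2 - m ^ 2) - kink k (x - z)) ^ 2 = 0 :=
      le_antisymm (by simpa using h1) (sq_nonneg _)
    exact sub_eq_zero.1 (pow_eq_zero_iff two_ne_zero |>.1 this)
  have hmf : m ≤ f x := by
    rcases hx.eq_or_lt with rfl | hx
    · exact hz.ge
    · exact (hgt x hx).le
  rw [modulus, ← h2, Real.sq_sqrt (by nlinarith), sub_add_cancel,
    Real.sqrt_sq (hm.le.trans hmf)]

theorem modulus_neg (m k x : ℝ) : modulus m k (-x) = modulus m k x := by
  simp [modulus, kink_neg]

/-- Integrals over the real line of functions that agree with `g` moved apart by a plateau. -/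
theorem integral_eq_add_of_plateau {f g : ℝ → ℝ} {a b C : ℝ} (hab : a ≤ b) (hf : Integrable f)
    (hg : Integrable g) (hl : ∀ x ≤ a, f x = g (x - a)) (hr : ∀ x, b < x → f x = g (x - b))
    (hm : ∀ x ∈ Ioc a b, f x = C) : ∫ x, f x = (∫ x, g x) + (b - a) * C := by
  have e1 : ∫ x in Iic a, f x = ∫ x in Iic 0, g x := by
    rw [setIntegral_congr_fun measurableSet_Iic (g := fun x => g (x - a)) fun x hx => hl x hx,
      ← integral_indicator measurableSet_Iic, ← integral_indicator measurableSet_Iic,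
      ← integral_sub_right_eq_self (fun x => (Iic (0 : ℝ)).indicator g x) a]
    refine integral_congr_ae (Eventually.of_forall fun x => ?_)
    simp [indicator_apply]
  have e2 : ∫ x in Ioi b, f x = ∫ x in Ioi 0, g x := by
    rw [setIntegral_congr_fun measurableSet_Ioi (g := fun x => g (x - b)) fun x hx => hr x hx,
      ← integral_indicator measurableSet_Ioi, ← integral_indicator measurableSet_Ioi,
      ← integral_sub_right_eq_self (fun x => (Ioi (0 : ℝ)).indicator g x) b]
    refine integral_congr_ae (Eventually.of_forall fun x => ?_)
    simp [indicator_apply]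
  have e3 : ∫ x in Ioc a b, f x = (b - a) * C := by
    rw [setIntegral_congr_fun measurableSet_Ioc (g := fun _ => C) fun x hx => hm x hx]
    simp [hab]
  have e4 : ∫ x in Ioi a, f x = (∫ x in Ioc a b, f x) + ∫ x in Ioi b, f x := by
    rw [← Ioc_union_Ioi_eq_Ioi hab, setIntegral_union (Ioc_disjoint_Ioi le_rfl) measurableSet_Ioi
      hf.integrableOn hf.integrableOn]
  rw [← intervalIntegral.integral_Iic_add_Ioi (b := a) hf.integrableOn hf.integrableOn,
    ← intervalIntegral.integral_Iic_add_Ioi (b := 0) hg.integrableOn hg.integrableOn, e1, e4, e2,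
    e3]
  ring

/-- If `f` is absolutely continuous and its derivative agrees with a continuous function to the
right of `z`, then `f` is differentiable there. -/
theorem HasACDeriv.hasDerivAt_of_ae_eq {f g u : ℝ → ℝ} {s : Set ℝ} (h : HasACDeriv f g)
    (hu : Continuous u) (hs : IsOpen s) (hsc : s.OrdConnected)
    (hgu : ∀ᵐ x, x ∈ s → g x = u x) {x : ℝ} (hx : x ∈ s) : HasDerivAt f (u x) x := by
  have h1 : HasDerivAt (fun y => f x + ∫ t in x..y, u t) (u x) x :=
    (hu.integral_hasStrictDerivAt x x).hasDerivAt.const_add _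
  refine h1.congr_of_eventuallyEq ?_
  filter_upwards [hs.mem_nhds hx] with y hy
  have h2 : ∫ t in x..y, u t = ∫ t in x..y, g t := by
    refine intervalIntegral.integral_congr_ae ?_
    filter_upwards [hgu] with t ht htm
    exact (ht (hsc.uIcc_subset hx hy (uIoc_subset_uIcc htm))).symm
  rw [h2, h.integral_eq]
  ring

namespace IsPolarPair

variable {ρ φ r q : ℝ → ℝ} {t : ℝ}

theorem eq_modulus_of_energy_eq (h : IsPolarPair ρ φ r q) (ht : t ∈ Ioo 0 (Real.pi / 2))
    (hp : (1 / 2) * ∫ x, (1 - ρ x ^ 2) * q x = angleMomentum t)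
    (hE : ∫ x, polarDensity ρ r q x = 2 * √2 / 3 * Real.sin t ^ 3) :
    ∃ a, ∀ x, ρ x = modulus (Real.cos t) (Real.sin t) (x - a) := by
  obtain ⟨hs, hc⟩ := sin_cos_pos ht
  have hmk : Real.cos t ^ 2 + Real.sin t ^ 2 = 1 := Real.cos_sq_add_sin_sq t
  obtain ⟨z, hzt, hz⟩ := (h.energy_ge ht hp).2 hE
  have heq := fun {y : ℝ} (hy : ρ y = Real.cos t) =>
    h.ae_eq_of_energy_eq ht hp hE hy fun x => by rw [hy, ← hzt]; exact hz x
  have hpk : angleMomentum t = Real.arctan (Real.sin t / Real.cos t) -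
      Real.cos t * Real.sin t := by
    rw [arctan_sin_div_cos ht, angleMomentum, mul_comm]
  set m := Real.cos t
  set k := Real.sin t
  rw [hzt] at hz
  have hm1 : m < 1 := by nlinarith
  have hρ := h.hasACDeriv_modulus.continuous
  have hslope : Continuous fun x => slope m (ρ x) := (continuous_slope hc).comp hρ
  -- As `ρ → 1 > m` at `±∞`, the minimum points form a compact set; its extreme points `a ≤ b` bound
  -- the possible plateau.
  have hcpt : IsCompact {x | ρ x = m} := by
    have hev : ∀ᶠ x in cocompact ℝ, ρ x ≠ m := by
      rw [cocompact_eq_atBot_atTop]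
      exact eventually_sup.2 ⟨h.tendsto_modulus.2.eventually_ne hm1.ne',
        h.tendsto_modulus.1.eventually_ne hm1.ne'⟩
    obtain ⟨K, hK, hKs⟩ := mem_cocompact.1 hev
    refine hK.of_isClosed_subset (isClosed_eq hρ continuous_const) fun x hx => ?_
    by_contra hxK
    exact hKs hxK hx
  obtain ⟨a, ha, ha'⟩ := hcpt.exists_isLeast ⟨z, hzt⟩
  obtain ⟨b, hb, hb'⟩ := hcpt.exists_isGreatest ⟨z, hzt⟩
  have hab : a ≤ b := ha' hb
  simp only [mem_ofPred_eq] at ha hb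
  have hright : ∀ x, b ≤ x → ρ x = modulus m k (x - b) := fun x hx => by
    refine eq_modulus_of_hasDerivAt hc hs hmk hρ hb (fun y hy => (hz y).lt_of_ne fun hy' =>
      (hb' hy'.symm).not_gt hy) (fun y hy => ?_) hx
    refine h.hasACDeriv_modulus.hasDerivAt_of_ae_eq hslope isOpen_Ioi ordConnected_Ioi (s := Ioi b) ?_ hy
    filter_upwards [(heq hb).1] with y hy hyb
    rw [hy, if_neg (not_le.2 hyb), one_mul]
  have hleft : ∀ x ≤ a, ρ x = modulus m k (x - a) := fun x hx => by
    -- The reflection `y ↦ -y` reverses the sign in the equation to the left of `a`.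
    have h1 := eq_modulus_of_hasDerivAt (f := fun y => ρ (-y)) (z := -a) hc hs hmk
      (hρ.comp continuous_neg) (by simpa using ha) (fun y hy => (hz _).lt_of_ne fun hy' =>
      (ha' hy'.symm).not_gt (by linarith)) (fun y hy => ?_) (x := -x) (by linarith)
    · simp only [neg_neg] at h1
      rw [h1, ← modulus_neg]
      congr 1
      ring
    · have h2 : HasDerivAt ρ (-slope m (ρ (-y))) (-y) := by
        refine h.hasACDeriv_modulus.hasDerivAt_of_ae_eq (u := fun y => -slope m (ρ y)) hslope.neg isOpen_Iio
          ordConnected_Iio (s := Iio a) ?_ (show -y < a by linarith)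
        filter_upwards [(heq ha).1] with y hy hyb
        rw [hy, if_pos (le_of_lt hyb), neg_one_mul]
      have h3 := h2.comp y (hasDerivAt_neg y)
      simpa [Function.comp_def] using h3
  -- The equality case holds at both minimum points `a` and `b`. Between them the two equations for
  -- `ρ'` have opposite signs, so `ρ' = 0`.
  have hmid : ∀ x ∈ Icc a b, ρ x = m := by
    intro x hx
    have h1 : ∫ y in a..x, r y = 0 := by
      rw [intervalIntegral.integral_congr_ae (g := fun _ => 0)]
      · simp
      · filter_upwards [(heq ha).1, (heq hb).1] with y hya hyb hy
        rw [uIoc_of_le hx.1] at hy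
        rw [if_neg (not_le.2 hy.1)] at hya
        rw [if_pos (hy.2.trans hx.2)] at hyb
        linarith
    rw [h.hasACDeriv_modulus.integral_eq, ha] at h1
    linarith
  have hR := integral_modulus_momentum hmk hc hs
  have hmom : (fun x => (1 - ρ x ^ 2) * q x) =ᵐ[volume]
      fun x => (1 - ρ x ^ 2) * (m * (1 - ρ x ^ 2) / (√2 * ρ x ^ 2)) := by
    filter_upwards [(heq hzt).2] with x hx
    rw [hx]
  -- The momentum integral is that of the soliton plus `(b - a) C` with `C > 0`. Both momenta equal
  -- `angleMomentum t`, hence `b = a`.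
  have hpl := integral_eq_add_of_plateau (C := (1 - m ^ 2) * (m * (1 - m ^ 2) / (√2 * m ^ 2)))
    hab (h.integrable_momentum.congr hmom) hR.1 (fun x hx => by rw [hleft x hx])
    (fun x hx => by rw [hright x hx.le]) (fun x hx => by rw [hmid x (Ioc_subset_Icc_self hx)])
  rw [← integral_congr_ae hmom] at hpl
  have hC : 0 < (1 - m ^ 2) * (m * (1 - m ^ 2) / (√2 * m ^ 2)) := by
    have : 0 < 1 - m ^ 2 := by nlinarith
    positivity
  have hba : (b - a) * ((1 - m ^ 2) * (m * (1 - m ^ 2) / (√2 * m ^ 2))) = 0 := by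
    linarith [hR.2]
  have hba' : b = a := by
    rcases mul_eq_zero.1 hba with h1 | h1
    · linarith
    · exact absurd h1 hC.ne'
  refine ⟨a, fun x => ?_⟩
  rcases le_total x a with hx | hx
  · exact hleft x hx
  · rw [← hba'] at hx ⊢
    exact hright x hx

/-- Once `ρ` is known, so is `φ'`, and integrating from `a` determines `φ` up to a constant. -/
theorem eq_phase_of_energy_eq (h : IsPolarPair ρ φ r q) (ht : t ∈ Ioo 0 (Real.pi / 2))
    (hp : (1 / 2) * ∫ x, (1 - ρ x ^ 2) * q x = angleMomentum t)
    (hE : ∫ x, polarDensity ρ r q x = 2 * √2 / 3 * Real.sin t ^ 3) :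
    ∃ a α, ∀ x, ρ x = modulus (Real.cos t) (Real.sin t) (x - a) ∧
      φ x = phase (Real.cos t) (Real.sin t) (x - a) + α := by
  obtain ⟨hs, hc⟩ := sin_cos_pos ht
  obtain ⟨a, ha⟩ := h.eq_modulus_of_energy_eq ht hp hE
  obtain ⟨z, hzt, hz⟩ := (h.energy_ge ht hp).2 hE
  have hq := (h.ae_eq_of_energy_eq ht hp hE hzt hz).2
  set m := Real.cos t
  set k := Real.sin t
  refine ⟨a, φ a - phase m k 0, fun x => ⟨ha x, ?_⟩⟩
  have h1 : ∫ y in a..x, q y =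
      ∫ y in a..x, m * (1 - modulus m k (y - a) ^ 2) / (√2 * modulus m k (y - a) ^ 2) := by
    refine intervalIntegral.integral_congr_ae ?_
    filter_upwards [hq] with y hy _
    rw [hy, ha]
  have h2 := intervalIntegral.integral_eq_sub_of_hasDerivAt (a := a) (b := x)
    (fun y _ => (hasDerivAt_phase (Real.cos_sq_add_sin_sq t) hc (y - a)).comp_sub_const y a)
    (((continuous_phase_deriv hc).comp
      (continuous_id.sub (continuous_const (y := a)))).intervalIntegrable _ _)
  rw [h.hasACDeriv_phase.integral_eq] at h1
  rw [sub_self] at h2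
  linarith

end IsPolarPair

/-! ### The minimization problem -/

theorem admissible_energy_ge {t : ℝ} (ht : t ∈ Ioo 0 (Real.pi / 2)) {v : ℝ → ℂ}
    (hv : v ∈ admissible (angleMomentum t)) :
    ENNReal.ofReal (2 * √2 / 3 * Real.sin t ^ 3) ≤ energy v ∧
      (energy v = ENNReal.ofReal (2 * √2 / 3 * Real.sin t ^ 3) → ∃ a α : ℝ, v =ᵐ[volume]
        fun x => Complex.exp (Complex.I * (α : ℂ)) *
          darkSoliton (Real.cos t) (Real.sin t) (x - a)) := by
  obtain ⟨hs, hc⟩ := sin_cos_pos ht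
  obtain ⟨hH, hE, hp⟩ := hv
  -- The momentum is positive, which gives access to polar coordinates through `exists_isPolarPair`.
  have hpos : 0 < angleMomentum t := by
    have := strictMonoOn_angleMomentum ⟨le_rfl, by positivity⟩ (Ioo_subset_Icc_self ht) ht.1
    simpa [angleMomentum] using this
  obtain ⟨ρ, φ, r, q, hpol, hpair, he, hm⟩ := exists_isPolarPair hH
    (hE.trans ENNReal.ofReal_lt_top) (by rw [hp]; exact hpos.ne')
  rw [hp] at hm
  refine ⟨?_, fun heq => ?_⟩
  · rw [he]
    exact ENNReal.ofReal_le_ofReal (hpair.energy_ge ht hm.symm).1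
  · rw [he, ENNReal.ofReal_eq_ofReal_iff (integral_nonneg (polarDensity_nonneg _ _ _))
      (by positivity)] at heq
    obtain ⟨a, α, h⟩ := hpair.eq_phase_of_energy_eq ht hm.symm heq
    refine ⟨a, α, ?_⟩
    filter_upwards [hpol.ae_eq] with x hx
    rw [hx, (h x).1, (h x).2, darkSoliton_eq hc]
    push_cast
    rw [mul_add, Complex.exp_add]
    ring

theorem admissible_of_ae_eq_darkSoliton {t a α : ℝ} (ht : t ∈ Ioo 0 (Real.pi / 2)) {v : ℝ → ℂ}
    (hv : v =ᵐ[volume] fun x => Complex.exp (Complex.I * (α : ℂ)) *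
          darkSoliton (Real.cos t) (Real.sin t) (x - a)) :
    v ∈ admissible (angleMomentum t) ∧
      energy v = ENNReal.ofReal (2 * √2 / 3 * Real.sin t ^ 3) := by
  obtain ⟨hs, hc⟩ := sin_cos_pos ht
  have hE := energy_of_ae_eq_darkSoliton (Real.cos_sq_add_sin_sq t) hs hv
  refine ⟨⟨memH1loc_of_ae_eq_darkSoliton hv, ?_, ?_⟩, hE⟩
  · rw [hE]
    refine (ENNReal.ofReal_lt_ofReal_iff (by positivity)).2 ?_
    have h1 : Real.sin t < 1 := by nlinarith [Real.sin_sq_add_cos_sq t]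
    exact mul_lt_of_lt_one_right (by positivity) (pow_lt_one₀ hs.le h1 (by norm_num))
  · rw [renormalizedMomentum_of_ae_eq_darkSoliton (Real.cos_sq_add_sin_sq t) hc hs hv,
      arctan_sin_div_cos ht, angleMomentum, mul_comm]

end
end GP

theorem mainTheorem2 (𝔭 : ℝ) (h_pos : 0 < 𝔭) (h_lt : 𝔭 < Real.pi / 2) :
    (∃! c : ℝ, GP.IsSpeed 𝔭 c) ∧
    ∀ c : ℝ, GP.IsSpeed 𝔭 c →
      (GP.admissible 𝔭).Nonempty ∧
      GP.energy (GP.soliton c) = GP.minEnergy 𝔭 ∧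
      GP.IsMinimizer 𝔭 (GP.soliton c) ∧
      ∀ v : ℝ → ℂ, GP.IsMinimizer 𝔭 v ↔
        ∃ a θ : ℝ, v =ᵐ[volume]
          fun x => Complex.exp (Complex.I * (θ : ℂ)) * GP.soliton c (x - a) := by
  refine ⟨GP.existsUnique_isSpeed h_pos h_lt, fun c hcs => ?_⟩
  obtain ⟨t, ht, rfl, rfl⟩ := GP.isSpeed_iff.1 hcs
  rw [GP.soliton_eq_darkSoliton ht]
  obtain ⟨hadm, hE⟩ := GP.admissible_of_ae_eq_darkSoliton (a := 0) (α := 0) ht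
    (v := GP.darkSoliton (Real.cos t) (Real.sin t)) (by simp)
  have hmin : GP.minEnergy (GP.angleMomentum t) =
      ENNReal.ofReal (2 * √2 / 3 * Real.sin t ^ 3) :=
    le_antisymm (hE ▸ iInf₂_le _ hadm)
      (le_iInf₂ fun v hv => (GP.admissible_energy_ge ht hv).1)
  refine ⟨⟨_, hadm⟩, hE.trans hmin.symm, ⟨hadm, hE.trans hmin.symm⟩, fun v => ⟨fun hv => ?_, ?_⟩⟩
  · exact (GP.admissible_energy_ge ht hv.1).2 (hv.2.trans hmin)
  · rintro ⟨a, θ, hv⟩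
    obtain ⟨h1, h2⟩ := GP.admissible_of_ae_eq_darkSoliton ht hv
    exact ⟨h1, h2.trans hmin.symm⟩
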